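/- **Proposition 5.1.** Let $M,N\ge 0$ and let $Y=Y(\mathfrak{gl}_{M|N})$ be the super Yangian: the associative $\mathbb{Z}_2$-graded $\mathbb{C}$-algebra with generators $t_{ij}^{(r)}$ ($1\le i,j\le M+N$, $r\ge 0$), where $t_{ij}^{(0)}=\delta_{ij}$, and relations $$[t_{ij}^{(r)},t_{hk}^{(s)}]=(-1)^{\bar i\bar j+\bar i\bar h+\bar j\bar h}\sum_{t=0}^{\min(r,s)-1}\Big(t_{hj}^{(t)}t_{ik}^{(r+s-1-t)}-t_{hj}^{(r+s-1-t)}t_{ik}^{(t)}\Big),$$ where $\bar i=0$ for $i\le M$ and $\bar i=1$ for $i>M$, the generator $t_{ij}^{(r)}$ with $r>0$ has parity $\bar i+\bar j$, and $[\cdot,\cdot]$ is the supercommutator. Put $t_{ij}(u)=\sum_{r\ge0}t_{ij}^{(r)}u^{-r}$ and $T(u)=(t_{ij}(u))_{1\le i,j\le M+N}$. Let $$T(u)=\begin{pmatrix}I_M&0\\F(u)&I_N\end{pmatrix}\begin{pmatrix}D_1(u)&0\\0&D_2(u)\end{pmatrix}\begin{pmatrix}I_M&E(u)\\0&I_N\end{pmatrix}$$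 be the unique Gauss decomposition of $T(u)$ into blocks of sizes $M$ and $N$, over $Y[[u^{-1}]]$. Let $D_{a;i,j}(u)$, $E_{i,j}(u)$, $F_{i,j}(u)$ be the entries of $D_a(u)$, $E(u)$, $F(u)$, and let $D'_{1;i,j}(u)$ be the entries of $D'_1(u)=D_1(u)^{-1}$. For series $A(u)=\sum_r A^{(r)}u^{-r}$ and $B(v)=\sum_s B^{(s)}v^{-s}$ write $[A(u),B(v)]=\sum_{r,s}[A^{(r)},B^{(s)}]u^{-r}v^{-s}$. Then the following identities hold in $Y((u^{-1},v^{-1}))$, the localization of $Y[[u^{-1},v^{-1}]]$ at the non-zero elements of $\mathbb{C}[[u^{-1},v^{-1}]]$, for all admissible $i,j,h,k$: $$(u-v)[D_{1;i,j}(u),E_{h,k}(v)]=\delta_{hj}\sum_{p=1}^{M}D_{1;i,p}(u)\big(E_{p,k}(v)-E_{p,k}(u)\big),$$ $$(u-v)[D_{2;i,j}(u),E_{h,k}(v)]=D_{2;i,k}(u)\big(E_{h,j}(v)-E_{h,j}(u)\big),$$ $$(u-v)[D_{1;i,j}(u),F_{h,k}(v)]=\delta_{ki}\sum_{p=1}^{M}\big(F_{h,p}(u)-F_{h,p}(v)\big)D_{1;p,j}(u),$$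 $$(u-v)[D_{2;i,j}(u),F_{h,k}(v)]=\big(F_{i,k}(u)-F_{i,k}(v)\big)D_{2;h,j}(u),$$ $$(u-v)[E_{i,j}(u),F_{h,k}(v)]=D'_{1;i,k}(v)D_{2;h,j}(v)-D_{2;h,j}(u)D'_{1;i,k}(u),$$ $$(u-v)[E_{i,j}(u),E_{h,k}(v)]=\big(E_{i,k}(u)-E_{i,k}(v)\big)\big(E_{h,j}(v)-E_{h,j}(u)\big),$$ $$(u-v)[F_{i,j}(u),F_{h,k}(v)]=\big(F_{i,k}(u)-F_{i,k}(v)\big)\big(F_{h,j}(v)-F_{h,j}(u)\big).$$ -/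

import Mathlib

open scoped Matrix

noncomputable section

namespace SuperYangian

/-! ### The super Yangian `Y(gl_{M|N})` -/

/-- The index set `{1, …, M+N}` in its two blocks: `Sum.inl i` is the (even) index `i ≤ M`,
`Sum.inr j` is the (odd) index `M + j`. -/
abbrev Idx (M N : ℕ) : Type := Fin M ⊕ Fin N

/-- The parity of an index: `0` on the first block and `1` on the second. -/
def par {M N : ℕ} : Idx M N → ℕ
  | Sum.inl _ => 0
  | Sum.inr _ => 1

/-- The free algebra on symbols `t_{ij}^{(r)}`, `r ≥ 0`. -/
abbrev Free (M N : ℕ) : Type := FreeAlgebra ℂ (Idx M N × Idx M N × ℕ)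

/-- The symbol `t_{ij}^{(r)}` in the free algebra. -/
def gen {M N : ℕ} (i j : Idx M N) (r : ℕ) : Free M N := FreeAlgebra.ι ℂ (i, j, r)

/-- The defining relations of the super Yangian: `t_{ij}^{(0)} = δ_{ij}`, and the relation for the
supercommutator of `t_{ij}^{(r)}` (of parity `par i + par j`) with `t_{hk}^{(s)}`. In the sum
`t < min r s`, so no subtraction below truncates. -/
inductive Rel (M N : ℕ) : Free M N → Free M N → Prop
  | zero (i j : Idx M N) : Rel M N (gen i j 0) (if i = j then 1 else 0)
  | comm (i j h k : Idx M N) (r s : ℕ) : Rel M N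
      (gen i j r * gen h k s
        - (-1 : ℂ) ^ ((par i + par j) * (par h + par k)) • (gen h k s * gen i j r))
      ((-1 : ℂ) ^ (par i * par j + par i * par h + par j * par h) •
        ∑ t ∈ Finset.range (min r s),
          (gen h j t * gen i k (r + s - 1 - t) - gen h j (r + s - 1 - t) * gen i k t))

/-- The super Yangian `Y(gl_{M|N})` as an associative algebra. -/
def Yangian (M N : ℕ) : Type := RingQuot (Rel M N)

instance (M N : ℕ) : Ring (Yangian M N) := inferInstanceAs (Ring (RingQuot (Rel M N)))

instance (M N : ℕ) : Algebra ℂ (Yangian M N) :=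
  inferInstanceAs (Algebra ℂ (RingQuot (Rel M N)))

/-- The quotient map from the free algebra. -/
def proj (M N : ℕ) : Free M N →ₐ[ℂ] Yangian M N := RingQuot.mkAlgHom ℂ (Rel M N)

/-- The generator `t_{ij}^{(r)}` of the super Yangian. -/
def t {M N : ℕ} (i j : Idx M N) (r : ℕ) : Yangian M N := proj M N (gen i j r)

theorem t_zero {M N : ℕ} (i j : Idx M N) : t i j 0 = if i = j then 1 else 0 := by
  have h : proj M N (gen i j 0) = proj M N (if i = j then 1 else 0) :=
    RingQuot.mkAlgHom_rel ℂ (Rel.zero i j)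
  rw [t, h]
  split_ifs <;> simp

theorem t_comm {M N : ℕ} (i j h k : Idx M N) (r s : ℕ) :
    t i j r * t h k s
        - (-1 : ℂ) ^ ((par i + par j) * (par h + par k)) • (t h k s * t i j r)
      = (-1 : ℂ) ^ (par i * par j + par i * par h + par j * par h) •
        ∑ x ∈ Finset.range (min r s),
          (t h j x * t i k (r + s - 1 - x) - t h j (r + s - 1 - x) * t i k x) := by
  have h := RingQuot.mkAlgHom_rel ℂ (Rel.comm i j h k r s)
  change proj M N _ = proj M N _ at h
  simpa only [t, map_sub, map_mul, map_smul, map_sum] using h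

/-! ### The `ℤ/2`-grading and the supercommutator -/

theorem neg_one_pow_par {M N : ℕ} (i : Idx M N) :
    (-1 : ℂ) ^ par i * (-1 : ℂ) ^ par i = 1 := by
  rw [← mul_pow]; simp

/-- The map of the free algebra multiplying the symbol `t_{ij}^{(r)}` by
`(-1) ^ (par i + par j)`, composed with the quotient map. -/
def signFree (M N : ℕ) : Free M N →ₐ[ℂ] Yangian M N :=
  FreeAlgebra.lift ℂ fun x => (-1 : ℂ) ^ (par x.1 + par x.2.1) • t x.1 x.2.1 x.2.2

theorem signFree_gen {M N : ℕ} (i j : Idx M N) (r : ℕ) :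
    signFree M N (gen i j r) = (-1 : ℂ) ^ (par i + par j) • t i j r := by
  simp [signFree, gen]

theorem signFree_rel {M N : ℕ} ⦃x y : Free M N⦄ (h : Rel M N x y) :
    signFree M N x = signFree M N y := by
  cases h with
  | zero i j =>
    rw [signFree_gen, t_zero]
    split_ifs with h
    · subst h
      rw [pow_add, neg_one_pow_par]
      simp
    · simp
  | comm i j h k r s =>
    have e : ((-1 : ℂ) ^ (par h + par j)) * ((-1 : ℂ) ^ (par i + par k))
        = ((-1 : ℂ) ^ (par i + par j)) * ((-1 : ℂ) ^ (par h + par k)) := by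
      simp only [pow_add]; ring
    have e' : ((-1 : ℂ) ^ (par h + par k)) * ((-1 : ℂ) ^ (par i + par j))
        = ((-1 : ℂ) ^ (par i + par j)) * ((-1 : ℂ) ^ (par h + par k)) := mul_comm _ _
    have key := congrArg
      (fun z => (((-1 : ℂ) ^ (par i + par j)) * ((-1 : ℂ) ^ (par h + par k))) • z)
      (t_comm i j h k r s)
    simp only [map_sub, map_mul, map_smul, map_sum, signFree_gen, smul_mul_smul_comm, e, e']
    simp only [← smul_sub, ← Finset.smul_sum]
    rw [smul_comm _ (_ * _), ← smul_sub]
    rw [smul_comm _ (_ * _)]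
    exact key

/-- The parity automorphism of the super Yangian: it sends `t_{ij}^{(r)}` to
`(-1) ^ (par i + par j) t_{ij}^{(r)}`. It is `1` on the even part and `-1` on the odd part of the
`ℤ/2`-grading in which `t_{ij}^{(r)}` has degree `par i + par j`. -/
def sgn (M N : ℕ) : Yangian M N →ₐ[ℂ] Yangian M N :=
  RingQuot.liftAlgHom ℂ ⟨signFree M N, signFree_rel⟩

theorem sgn_t {M N : ℕ} (i j : Idx M N) (r : ℕ) :
    sgn M N (t i j r) = (-1 : ℂ) ^ (par i + par j) • t i j r := by
  rw [← signFree_gen]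
  exact RingQuot.liftAlgHom_mkAlgHom_apply ℂ (signFree M N) signFree_rel (gen i j r)

/-- The even component of an element. -/
def evenPart {M N : ℕ} (a : Yangian M N) : Yangian M N := (2⁻¹ : ℂ) • (a + sgn M N a)

/-- The odd component of an element. -/
def oddPart {M N : ℕ} (a : Yangian M N) : Yangian M N := (2⁻¹ : ℂ) • (a - sgn M N a)

/-- The supercommutator: the bilinear map with `[a, b] = a b - (-1)^{|a||b|} b a` for homogeneous
`a` and `b`. -/
def sbr {M N : ℕ} (a b : Yangian M N) : Yangian M N :=
  a * b - (evenPart b * evenPart a + evenPart b * oddPart a + oddPart b * evenPart a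
    - oddPart b * oddPart a)

theorem sbr_of_homogeneous {M N : ℕ} (a b : Yangian M N) (p q : ℕ)
    (ha : sgn M N a = (-1 : ℂ) ^ p • a) (hb : sgn M N b = (-1 : ℂ) ^ q • b) :
    sbr a b = a * b - (-1 : ℂ) ^ (p * q) • (b * a) := by
  have h2 : ∀ x : Yangian M N, (2⁻¹ : ℂ) • (x + x) = x := fun x => by
    rw [← two_smul ℂ x, smul_smul]; norm_num
  rw [pow_mul]
  rcases neg_one_pow_eq_or ℂ p with hp | hp <;> rcases neg_one_pow_eq_or ℂ q with hq | hq <;>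
    simp [sbr, evenPart, oddPart, ha, hb, hp, hq, h2]

/-! ### The matrix `T(u)` and its Gauss decomposition -/

/-- The generating series `t_{ij}(u)`, a power series in the variable `u⁻¹`. -/
def tSeries {M N : ℕ} (i j : Idx M N) : PowerSeries (Yangian M N) :=
  PowerSeries.mk fun r => t i j r

/-- The matrix `T(u)`. -/
def T (M N : ℕ) : Matrix (Idx M N) (Idx M N) (PowerSeries (Yangian M N)) :=
  Matrix.of fun i j => tSeries i j

/-- A Gauss decomposition `T = F D E` of a `2 × 2` block matrix: `D` is block diagonal with
diagonal blocks `D₁`, `D₂`, and `E`, `F` are block unitriangular with off-diagonal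
blocks `E`, `F`. -/
@[ext]
structure GaussDecomposition {m n R : Type*} [Fintype m] [Fintype n] [DecidableEq m]
    [DecidableEq n] [Ring R] (T : Matrix (m ⊕ n) (m ⊕ n) R) where
  D₁ : Matrix m m R
  D₂ : Matrix n n R
  E : Matrix m n R
  F : Matrix n m R
  eq : T = Matrix.fromBlocks 1 0 F 1 * Matrix.fromBlocks D₁ 0 0 D₂ * Matrix.fromBlocks 1 E 0 1

section Gauss

variable {m n R : Type*} [Fintype m] [Fintype n] [DecidableEq m] [DecidableEq n] [Ring R]
  {T : Matrix (m ⊕ n) (m ⊕ n) R}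

theorem GaussDecomposition.blocks (G : GaussDecomposition T) :
    T.toBlocks₁₁ = G.D₁ ∧ T.toBlocks₁₂ = G.D₁ * G.E ∧ T.toBlocks₂₁ = G.F * G.D₁ ∧
      T.toBlocks₂₂ = G.F * G.D₁ * G.E + G.D₂ := by
  have h := G.eq
  simp only [Matrix.fromBlocks_multiply, Matrix.one_mul, Matrix.zero_mul,
    Matrix.mul_zero, Matrix.mul_one, add_zero, zero_add] at h
  exact ⟨by simpa using congrArg Matrix.toBlocks₁₁ h, by simpa using congrArg Matrix.toBlocks₁₂ h,
    by simpa using congrArg Matrix.toBlocks₂₁ h, by simpa using congrArg Matrix.toBlocks₂₂ h⟩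

/-- The Gauss decomposition exists as soon as the leading block is invertible. -/
def gaussOfIsUnit (h : IsUnit T.toBlocks₁₁) : GaussDecomposition T where
  D₁ := T.toBlocks₁₁
  D₂ := T.toBlocks₂₂ - T.toBlocks₂₁ * (↑h.unit⁻¹ : Matrix m m R) * T.toBlocks₁₂
  E := (↑h.unit⁻¹ : Matrix m m R) * T.toBlocks₁₂
  F := T.toBlocks₂₁ * (↑h.unit⁻¹ : Matrix m m R)
  eq := by
    have h1 : T.toBlocks₁₁ * (↑h.unit⁻¹ : Matrix m m R) = 1 := h.mul_val_inv
    have h2 : (↑h.unit⁻¹ : Matrix m m R) * T.toBlocks₁₁ = 1 := h.val_inv_mul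
    conv_lhs => rw [← Matrix.fromBlocks_toBlocks T]
    simp only [Matrix.fromBlocks_multiply, Matrix.one_mul, Matrix.zero_mul,
      Matrix.mul_zero, Matrix.mul_one, add_zero, zero_add]
    rw [Matrix.fromBlocks_inj]
    refine ⟨rfl, ?_, ?_, ?_⟩
    · rw [← Matrix.mul_assoc, h1, Matrix.one_mul]
    · rw [Matrix.mul_assoc, h2, Matrix.mul_one]
    · rw [Matrix.mul_assoc T.toBlocks₂₁ _ T.toBlocks₁₁, h2, Matrix.mul_one, ← Matrix.mul_assoc]
      abel

/-- The Gauss decomposition is unique when the leading block is invertible. -/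
theorem GaussDecomposition.unique (h : IsUnit T.toBlocks₁₁) (G H : GaussDecomposition T) :
    G = H := by
  obtain ⟨g1, g2, g3, g4⟩ := G.blocks
  obtain ⟨h1, h2, h3, h4⟩ := H.blocks
  have hD : G.D₁ = H.D₁ := g1.symm.trans h1
  have hu : IsUnit H.D₁ := h1 ▸ h
  have i1 : H.D₁ * (↑hu.unit⁻¹ : Matrix m m R) = 1 := hu.mul_val_inv
  have i2 : (↑hu.unit⁻¹ : Matrix m m R) * H.D₁ = 1 := hu.val_inv_mul
  have hE : G.E = H.E := by
    have e : H.D₁ * G.E = H.D₁ * H.E := by rw [← hD, ← g2, h2, hD]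
    have e' := congrArg (fun X => (↑hu.unit⁻¹ : Matrix m m R) * X) e
    simpa only [← Matrix.mul_assoc, i2, Matrix.one_mul] using e'
  have hF : G.F = H.F := by
    have e : G.F * H.D₁ = H.F * H.D₁ := by rw [← hD, ← g3, h3, hD]
    have e' := congrArg (fun X => X * (↑hu.unit⁻¹ : Matrix m m R)) e
    simpa only [Matrix.mul_assoc, i1, Matrix.mul_one] using e'
  have hD2 : G.D₂ = H.D₂ := by
    have e := g4.symm.trans h4
    rw [hD, hE, hF] at e
    exact add_left_cancel e
  exact GaussDecomposition.ext hD hD2 hE hF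

end Gauss

/-- A power series with matrix coefficients, read as a matrix of power series. -/
def swapSeries (n R : Type*) [Fintype n] [DecidableEq n] [Ring R] :
    PowerSeries (Matrix n n R) →+* Matrix n n (PowerSeries R) where
  toFun f := Matrix.of fun i j => PowerSeries.mk fun r => PowerSeries.coeff r f i j
  map_one' := by
    ext i j r
    by_cases h : r = 0 <;> by_cases h' : i = j <;>
      simp [PowerSeries.coeff_one, Matrix.one_apply, h, h']
  map_zero' := by ext i j r; simp
  map_add' f g := by ext i j r; simp
  map_mul' f g := by
    ext i j r
    simp only [Matrix.of_apply, PowerSeries.coeff_mk, PowerSeries.coeff_mul, Matrix.mul_apply,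
      Matrix.sum_apply, map_sum]
    exact Finset.sum_comm

theorem isUnit_T₁₁ (M N : ℕ) : IsUnit (T M N).toBlocks₁₁ := by
  have e : (T M N).toBlocks₁₁ = swapSeries (Fin M) (Yangian M N)
      (PowerSeries.mk fun r => Matrix.of fun i j => t (Sum.inl i) (Sum.inl j) r) := by
    ext i j r
    simp [T, tSeries, swapSeries, Matrix.toBlocks₁₁]
  rw [e]
  apply IsUnit.map
  have hc : PowerSeries.constantCoeff
      (PowerSeries.mk fun r => (Matrix.of fun i j => t (Sum.inl i) (Sum.inl j) r :
        Matrix (Fin M) (Fin M) (Yangian M N))) = ((1 : (Matrix (Fin M) (Fin M) (Yangian M N))ˣ) :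
          Matrix (Fin M) (Fin M) (Yangian M N)) := by
    rw [← PowerSeries.coeff_zero_eq_constantCoeff_apply, PowerSeries.coeff_mk]
    ext i j
    simp [t_zero, Matrix.one_apply]
  exact ⟨⟨_, _, PowerSeries.mul_invOfUnit _ 1 hc, PowerSeries.invOfUnit_mul _ 1 hc⟩, rfl⟩

/-- The Gauss decomposition of `T(u)` for the composition `(M | N)`. -/
def gauss (M N : ℕ) : GaussDecomposition (T M N) := gaussOfIsUnit (isUnit_T₁₁ M N)

/-- `D_{1;i,j}(u)`. -/
def D₁ {M N : ℕ} (i j : Fin M) : PowerSeries (Yangian M N) := (gauss M N).D₁ i j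

/-- `D_{2;i,j}(u)`. -/
def D₂ {M N : ℕ} (i j : Fin N) : PowerSeries (Yangian M N) := (gauss M N).D₂ i j

/-- `E_{i,j}(u)`. -/
def E {M N : ℕ} (i : Fin M) (j : Fin N) : PowerSeries (Yangian M N) := (gauss M N).E i j

/-- `F_{i,j}(u)`. -/
def F {M N : ℕ} (i : Fin N) (j : Fin M) : PowerSeries (Yangian M N) := (gauss M N).F i j

theorem isUnit_D₁ (M N : ℕ) : IsUnit (gauss M N).D₁ := isUnit_T₁₁ M N

/-- `D'_{1;i,j}(u)`, the entries of the inverse matrix of `D_1(u)`. -/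
def D₁' {M N : ℕ} (i j : Fin M) : PowerSeries (Yangian M N) :=
  (↑(isUnit_D₁ M N).unit⁻¹ : Matrix (Fin M) (Fin M) (PowerSeries (Yangian M N))) i j

/-! ### Series in two variables -/

/-- `Y[[u⁻¹, v⁻¹]]`; the variable `0` is `u⁻¹` and the variable `1` is `v⁻¹`. -/
abbrev Ser (M N : ℕ) : Type := MvPowerSeries (Fin 2) (Yangian M N)

/-- `Y[[u⁻¹, v⁻¹]]` is an algebra over `ℂ[[u⁻¹, v⁻¹]]`. -/
instance (M N : ℕ) : Algebra (MvPowerSeries (Fin 2) ℂ) (Ser M N) :=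
  (MvPowerSeries.map (algebraMap ℂ (Yangian M N))).toAlgebra' fun c x => by
    classical
    ext n
    rw [MvPowerSeries.coeff_mul, MvPowerSeries.coeff_mul,
      ← Finset.HasAntidiagonal.map_swap_antidiagonal, Finset.sum_map]
    refine Finset.sum_congr Finset.HasAntidiagonal.map_swap_antidiagonal.symm fun p _ => ?_
    simp only [MvPowerSeries.coeff_map]
    exact Algebra.commutes _ _

/-- `Y((u⁻¹, v⁻¹))`: the localization of `Y[[u⁻¹, v⁻¹]]` at the non-zero elements of the domain
`ℂ[[u⁻¹, v⁻¹]]`. -/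
abbrev LSer (M N : ℕ) : Type :=
  LocalizedModule (nonZeroDivisors (MvPowerSeries (Fin 2) ℂ)) (Ser M N)

/-- The canonical map from `Y[[u⁻¹, v⁻¹]]` to its localization. -/
def toLSer {M N : ℕ} (f : Ser M N) : LSer M N := LocalizedModule.mk f 1

/-- The element `u` of `Y((u⁻¹, v⁻¹))`, that is `1 / u⁻¹`. -/
def varU (M N : ℕ) : LSer M N :=
  LocalizedModule.mk 1 ⟨MvPowerSeries.X 0, MvPowerSeries.X_mem_nonzeroDivisors⟩

/-- The element `v` of `Y((u⁻¹, v⁻¹))`, that is `1 / v⁻¹`. -/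
def varV (M N : ℕ) : LSer M N :=
  LocalizedModule.mk 1 ⟨MvPowerSeries.X 1, MvPowerSeries.X_mem_nonzeroDivisors⟩

/-- The series `A(u) = ∑ A^{(r)} u^{-r}` as an element of `Y((u⁻¹, v⁻¹))`. -/
def inU {M N : ℕ} (A : PowerSeries (Yangian M N)) : LSer M N :=
  toLSer fun n => if n 1 = 0 then PowerSeries.coeff (n 0) A else 0

/-- The series `A(v) = ∑ A^{(s)} v^{-s}` as an element of `Y((u⁻¹, v⁻¹))`. -/
def inV {M N : ℕ} (A : PowerSeries (Yangian M N)) : LSer M N :=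
  toLSer fun n => if n 0 = 0 then PowerSeries.coeff (n 1) A else 0

/-- The supercommutator `[A(u), B(v)] = ∑ [A^{(r)}, B^{(s)}] u^{-r} v^{-s}`. -/
def brUV {M N : ℕ} (A B : PowerSeries (Yangian M N)) : LSer M N :=
  toLSer fun n => sbr (PowerSeries.coeff (n 0) A) (PowerSeries.coeff (n 1) B)

end SuperYangian

end

noncomputable section

namespace SuperYangian

/-! ### Block decompositions satisfying exchange relations -/

/-! The defining relations telescope to one exchange relation: `u - v` times the superbracket of
`t_{ij}(u)` and `t_{hk}(v)` is, up to sign, `t_{hj}(u) t_{ik}(v) - t_{hj}(v) t_{ik}(u)`. Since `u -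
v = x / y` with `x = v⁻¹ - u⁻¹` and `y = u⁻¹ v⁻¹`, every identity is proved as `x • f = y • g` over
`Y[[u⁻¹, v⁻¹]]`, and the localization enters only at the end (`sub_mul_toLSer`).

Write `T` in blocks `a, b, c, d`, so that `e = a⁻¹ b`, `f = c a⁻¹` and `g = d - c a⁻¹ b`. The
relations for these factors come from the Leibniz rule followed by cancellation of the invertible
block `a`; for instance `a(v) [a(u), e(v)] = [a(u), b(v)] - [a(u), a(v)] e(v)` gives `Exchange.a_e`.
The pivot is `Exchange.a_g`: `a(u)` commutes with `g(v)`, because `x` annihilates no nonzero series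
(`num_smul_eq_zero`). It allows `a` to be moved past `g` and yields `e_f`, `g_e` and `g_f`.

For two factors `e` the same method gives less. Let `Z_{jk}` be the difference of the two sides of
the expected relation. Then `x Z_{jk} + y Z_{kj} = x y Q` with `Q` a series in `v` alone (`e_e_aux`;
`f_f_aux` for `f`, with rows exchanged). Comparing coefficients forces `Z = 0`
(`eq_zero_of_num_den`).

Finally `D₁`, `D₂` are even and `E`, `F` are odd, so each superbracket is an ordinary commutator or
anticommutator. -/

/-- The blocks `a`, `b`, `c`, `d` of a matrix, with the entries `a' = a⁻¹`, `e`, `f`, `g` of its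
block Gauss decomposition. -/
structure GaussBlocks (m n R : Type*) [Fintype m] [DecidableEq m] [Ring R] where
  a : m → m → R
  a' : m → m → R
  b : m → n → R
  c : n → m → R
  d : n → n → R
  e : m → n → R
  f : n → m → R
  g : n → n → R
  a_a' : ∀ i k, ∑ q, a i q * a' q k = if i = k then 1 else 0
  a'_a : ∀ i k, ∑ q, a' i q * a q k = if i = k then 1 else 0
  a_e : ∀ i k, ∑ q, a i q * e q k = b i k
  f_a : ∀ i k, ∑ q, f i q * a q k = c i k
  f_b : ∀ i k, ∑ q, f i q * b q k = d i k - g i k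
  c_e : ∀ i k, ∑ q, c i q * e q k = d i k - g i k

variable {m n K R : Type*} [Fintype m] [DecidableEq m] [CommRing K] [Ring R] [Algebra K R]

namespace GaussBlocks

theorem left_cancel (P : GaussBlocks m n R) {X Y : m → R}
    (h : ∀ i, ∑ q, P.a i q * X q = ∑ q, P.a i q * Y q) : X = Y := by
  have key : ∀ (Z : m → R) (k : m), ∑ i, P.a' k i * ∑ q, P.a i q * Z q = Z k := fun Z k => by
    simp only [Finset.mul_sum]
    rw [Finset.sum_comm]
    simp only [← mul_assoc, ← Finset.sum_mul, P.a'_a]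
    simp
  funext k
  rw [← key X, ← key Y]
  simp only [h]

theorem right_cancel (P : GaussBlocks m n R) {X Y : m → R}
    (h : ∀ k, ∑ q, X q * P.a q k = ∑ q, Y q * P.a q k) : X = Y := by
  have key : ∀ (Z : m → R) (j : m), ∑ k, (∑ q, Z q * P.a q k) * P.a' k j = Z j := fun Z j => by
    simp only [Finset.sum_mul]
    rw [Finset.sum_comm]
    simp only [mul_assoc, ← Finset.mul_sum, P.a_a']
    simp
  funext k
  rw [← key X, ← key Y]
  simp only [h]

end GaussBlocks

/-- The exchange relations between the blocks of two matrices, with `x : y` in the role of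
`u - v : 1`. The primed relations have the factors on the right-hand side in the opposite order. -/
structure Exchange (x y : K) (P Q : GaussBlocks m n R) : Prop where
  aa : ∀ i j h k, x • (P.a i j * Q.a h k - Q.a h k * P.a i j)
    = y • (P.a h j * Q.a i k - Q.a h j * P.a i k)
  ab : ∀ i j h k, x • (P.a i j * Q.b h k - Q.b h k * P.a i j)
    = y • (P.a h j * Q.b i k - Q.a h j * P.b i k)
  ac : ∀ i j h k, x • (P.a i j * Q.c h k - Q.c h k * P.a i j)
    = y • (P.c h j * Q.a i k - Q.c h j * P.a i k)
  ad : ∀ i j h k, x • (P.a i j * Q.d h k - Q.d h k * P.a i j)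
    = y • (P.c h j * Q.b i k - Q.c h j * P.b i k)
  ba : ∀ i j h k, x • (P.b i j * Q.a h k - Q.a h k * P.b i j)
    = y • (P.b h j * Q.a i k - Q.b h j * P.a i k)
  ca : ∀ i j h k, x • (P.c i j * Q.a h k - Q.a h k * P.c i j)
    = y • (P.a h j * Q.c i k - Q.a h j * P.c i k)
  bb : ∀ i j h k, x • (P.b i j * Q.b h k + Q.b h k * P.b i j)
    = y • (P.b h j * Q.b i k - Q.b h j * P.b i k)
  bc : ∀ i j h k, x • (P.b i j * Q.c h k + Q.c h k * P.b i j)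
    = y • (Q.d h j * P.a i k - P.d h j * Q.a i k)
  cc : ∀ i j h k, x • (P.c i j * Q.c h k + Q.c h k * P.c i j)
    = y • (Q.c h j * P.c i k - P.c h j * Q.c i k)
  ac' : ∀ i j h k, x • (P.a i j * Q.c h k - Q.c h k * P.a i j)
    = y • (Q.a i k * P.c h j - P.a i k * Q.c h j)
  bb' : ∀ i j h k, x • (P.b i j * Q.b h k + Q.b h k * P.b i j)
    = y • (P.b i k * Q.b h j - Q.b i k * P.b h j)
  bc' : ∀ i j h k, x • (P.b i j * Q.c h k + Q.c h k * P.b i j)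
    = y • (P.a i k * Q.d h j - Q.a i k * P.d h j)
  cc' : ∀ i j h k, x • (P.c i j * Q.c h k + Q.c h k * P.c i j)
    = y • (Q.c i k * P.c h j - P.c i k * Q.c h j)
  db' : ∀ i j h k, x • (P.d i j * Q.b h k - Q.b h k * P.d i j)
    = y • (P.d i k * Q.b h j - Q.d i k * P.b h j)
  dc' : ∀ i j h k, x • (P.d i j * Q.c h k - Q.c h k * P.d i j)
    = y • (P.c i k * Q.d h j - Q.c i k * P.d h j)

/-! ### Relations among the Gauss factors, by the Leibniz rule and cancellation of `a` -/

namespace Exchange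

variable {x y : K} {P Q : GaussBlocks m n R}

/-- Multiply by `a(v)` on the left and use `a e = b`. What remains is `a_{hj}(v)` times a sum that
does not involve `h`; cancelling `a(v)` turns this factor into the Kronecker delta. -/
theorem a_e (H : Exchange x y P Q) (i j h : m) (k : n) :
    x • (P.a i j * Q.e h k - Q.e h k * P.a i j)
      = y • (if h = j then ∑ q, P.a i q * (Q.e q k - P.e q k) else 0) := by
  refine congrFun (Q.left_cancel
    (X := fun h => x • (P.a i j * Q.e h k - Q.e h k * P.a i j))
    (Y := fun h => y • (if h = j then ∑ q, P.a i q * (Q.e q k - P.e q k) else 0)) fun h => ?_) h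
  have h1 : ∑ q, Q.a h q * (x • (P.a i j * Q.e q k - Q.e q k * P.a i j))
      = x • (P.a i j * Q.b h k - Q.b h k * P.a i j)
        - ∑ q, (x • (P.a i j * Q.a h q - Q.a h q * P.a i j)) * Q.e q k := by
    rw [← Q.a_e]
    simp only [Finset.mul_sum, Finset.sum_mul, Finset.smul_sum, ← Finset.sum_sub_distrib]
    refine Finset.sum_congr rfl fun q _ => ?_
    simp only [mul_sub, sub_mul, mul_smul_comm, smul_mul_assoc, mul_assoc]
    module
  have h2 : ∑ q, (x • (P.a i j * Q.a h q - Q.a h q * P.a i j)) * Q.e q k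
      = y • (P.a h j * Q.b i k - Q.a h j * ∑ q, P.a i q * Q.e q k) := by
    simp only [H.aa, ← Q.a_e, Finset.mul_sum, Finset.smul_sum, ← Finset.sum_sub_distrib, sub_mul,
      smul_mul_assoc, mul_assoc]
  rw [h1, h2, H.ab]
  simp only [mul_ite, mul_zero, smul_ite, smul_zero, Finset.sum_ite_eq', Finset.mem_univ, if_true,
    mul_smul_comm, mul_sub, Finset.sum_sub_distrib, P.a_e]
  module

theorem a_f (H : Exchange x y P Q) (i j : m) (h : n) (k : m) :
    x • (P.a i j * Q.f h k - Q.f h k * P.a i j)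
      = y • (if k = i then ∑ q, (P.f h q - Q.f h q) * P.a q j else 0) := by
  refine congrFun (Q.right_cancel
    (X := fun k => x • (P.a i j * Q.f h k - Q.f h k * P.a i j))
    (Y := fun k => y • (if k = i then ∑ q, (P.f h q - Q.f h q) * P.a q j else 0)) fun k => ?_) k
  have h1 : ∑ q, (x • (P.a i j * Q.f h q - Q.f h q * P.a i j)) * Q.a q k
      = x • (P.a i j * Q.c h k - Q.c h k * P.a i j)
        - ∑ q, Q.f h q * (x • (P.a i j * Q.a q k - Q.a q k * P.a i j)) := by
    rw [← Q.f_a]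
    simp only [Finset.mul_sum, Finset.sum_mul, Finset.smul_sum, ← Finset.sum_sub_distrib]
    refine Finset.sum_congr rfl fun q _ => ?_
    simp only [mul_sub, sub_mul, mul_smul_comm, smul_mul_assoc, mul_assoc]
    module
  have h2 : ∑ q, Q.f h q * (x • (P.a i j * Q.a q k - Q.a q k * P.a i j))
      = y • ((∑ q, Q.f h q * P.a q j) * Q.a i k - Q.c h j * P.a i k) := by
    simp only [H.aa, ← Q.f_a, Finset.sum_mul, Finset.smul_sum, ← Finset.sum_sub_distrib, mul_sub,
      mul_smul_comm, mul_assoc]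
  rw [h1, h2, H.ac]
  simp only [ite_mul, zero_mul, smul_ite, smul_zero, Finset.sum_ite_eq', Finset.mem_univ, if_true,
    smul_mul_assoc, sub_mul, Finset.sum_sub_distrib, P.f_a]
  module

/-- With `g = d - f b`, the contributions of `[a, d]`, `[a, f] b` and `f [a, b]` cancel after
multiplication by `x`, and `x` is then removed. -/
theorem a_g (H : Exchange x y P Q) (hx : ∀ z : R, x • z = 0 → z = 0) (i j : m) (h k : n) :
    P.a i j * Q.g h k = Q.g h k * P.a i j := by
  rw [← sub_eq_zero]
  apply hx
  have h0 : Q.g h k = Q.d h k - ∑ q, Q.f h q * Q.b q k := by rw [Q.f_b]; abel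
  have h1 : x • (P.a i j * Q.g h k - Q.g h k * P.a i j)
      = x • (P.a i j * Q.d h k - Q.d h k * P.a i j)
        - (∑ q, (x • (P.a i j * Q.f h q - Q.f h q * P.a i j)) * Q.b q k
          + ∑ q, Q.f h q * (x • (P.a i j * Q.b q k - Q.b q k * P.a i j))) := by
    have : ∑ q, (x • (P.a i j * Q.f h q - Q.f h q * P.a i j)) * Q.b q k
          + ∑ q, Q.f h q * (x • (P.a i j * Q.b q k - Q.b q k * P.a i j))
        = x • (P.a i j * ∑ q, Q.f h q * Q.b q k - (∑ q, Q.f h q * Q.b q k) * P.a i j) := by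
      simp only [Finset.mul_sum, Finset.sum_mul, Finset.smul_sum, ← Finset.sum_sub_distrib,
        ← Finset.sum_add_distrib]
      refine Finset.sum_congr rfl fun q _ => ?_
      simp only [mul_sub, sub_mul, mul_smul_comm, smul_mul_assoc, mul_assoc]
      module
    rw [this, h0]
    simp only [mul_sub, sub_mul]
    module
  have h2 : ∑ q, Q.f h q * (x • (P.a i j * Q.b q k - Q.b q k * P.a i j))
      = y • ((∑ q, Q.f h q * P.a q j) * Q.b i k - Q.c h j * P.b i k) := by
    simp only [H.ab, ← Q.f_a, Finset.sum_mul, Finset.smul_sum, ← Finset.sum_sub_distrib, mul_sub,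
      mul_smul_comm, mul_assoc]
  rw [h1, h2, H.ad]
  simp only [H.a_f, ite_mul, zero_mul, smul_ite, smul_zero, Finset.sum_ite_eq', Finset.mem_univ,
    if_true, smul_mul_assoc, sub_mul, Finset.sum_sub_distrib, P.f_a]
  module

theorem a'_g (H : Exchange x y P Q) (hx : ∀ z : R, x • z = 0 → z = 0) (i j : m) (h k : n) :
    P.a' i j * Q.g h k = Q.g h k * P.a' i j := by
  refine (congrFun (P.left_cancel (X := fun i => P.a' i j * Q.g h k)
    (Y := fun i => Q.g h k * P.a' i j) fun i => ?_) i)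
  have : ∀ q, P.a i q * (Q.g h k * P.a' q j) = Q.g h k * (P.a i q * P.a' q j) := fun q => by
    rw [← mul_assoc, H.a_g hx, mul_assoc]
  simp only [this, ← mul_assoc, ← Finset.sum_mul, P.a_a']
  simp only [mul_assoc, ← Finset.mul_sum, P.a_a']
  split_ifs <;> simp

/-- An intermediate relation for `e_f` and, with `u` and `v` exchanged, for `g_e`. The mixed product
`a(u) a'(v)` is what is left of `a(u)` after cancelling `a(v)` on the right. -/
theorem b_f (H : Exchange x y P Q) (i : m) (j h : n) (k : m) :
    x • (P.b i j * Q.f h k + Q.f h k * P.b i j)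
      = y • ((if k = i then ∑ q, Q.f h q * P.b q j - P.d h j else 0)
        + Q.g h j * ∑ q, P.a i q * Q.a' q k) := by
  refine congrFun (Q.right_cancel
    (X := fun k => x • (P.b i j * Q.f h k + Q.f h k * P.b i j))
    (Y := fun k => y • ((if k = i then ∑ q, Q.f h q * P.b q j - P.d h j else 0)
        + Q.g h j * ∑ q, P.a i q * Q.a' q k)) fun k => ?_) k
  have h1 : ∑ q, (x • (P.b i j * Q.f h q + Q.f h q * P.b i j)) * Q.a q k
      = x • (P.b i j * Q.c h k + Q.c h k * P.b i j)
        + ∑ q, Q.f h q * (x • (P.b i j * Q.a q k - Q.a q k * P.b i j)) := by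
    rw [← Q.f_a]
    simp only [Finset.mul_sum, Finset.sum_mul, Finset.smul_sum, ← Finset.sum_add_distrib]
    refine Finset.sum_congr rfl fun q _ => ?_
    simp only [mul_sub, add_mul, mul_smul_comm, smul_mul_assoc, mul_assoc]
    module
  have h2 : ∑ q, Q.f h q * (x • (P.b i j * Q.a q k - Q.a q k * P.b i j))
      = y • ((∑ q, Q.f h q * P.b q j) * Q.a i k - (Q.d h j - Q.g h j) * P.a i k) := by
    simp only [H.ba, ← Q.f_b, Finset.sum_mul, Finset.smul_sum, ← Finset.sum_sub_distrib, mul_sub,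
      mul_smul_comm, mul_assoc]
  have h3 : ∑ r, (∑ q, P.a i q * Q.a' q r) * Q.a r k = P.a i k := by
    simp only [Finset.sum_mul]
    rw [Finset.sum_comm]
    simp only [mul_assoc, ← Finset.mul_sum, Q.a'_a]
    simp
  rw [h1, h2, H.bc]
  simp only [smul_mul_assoc, add_mul, ← Finset.smul_sum, Finset.sum_add_distrib, ite_mul, zero_mul,
    Finset.sum_ite_eq', Finset.mem_univ, if_true]
  simp only [mul_assoc, ← Finset.mul_sum, h3, sub_mul]
  module

/-- Multiplying by `a(u)` on the left gives the bracket of `b` and `f` plus `[a, f] e`. The terms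
`f(v) b(u)` cancel and `f(u) b(u) - d(u)` collapses to `-g(u)`, while `a_g` brings `a(u)` to the
left of `g(v)` so that it can be cancelled. -/
theorem e_f (H : Exchange x y P Q) (hx : ∀ z : R, x • z = 0 → z = 0)
    (i : m) (j h : n) (k : m) :
    x • (P.e i j * Q.f h k + Q.f h k * P.e i j)
      = y • (Q.g h j * Q.a' i k - P.a' i k * P.g h j) := by
  refine congrFun (P.left_cancel
    (X := fun i => x • (P.e i j * Q.f h k + Q.f h k * P.e i j))
    (Y := fun i => y • (Q.g h j * Q.a' i k - P.a' i k * P.g h j)) fun i => ?_) i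
  have h1 : ∑ q, P.a i q * (x • (P.e q j * Q.f h k + Q.f h k * P.e q j))
      = x • (P.b i j * Q.f h k + Q.f h k * P.b i j)
        + ∑ q, (x • (P.a i q * Q.f h k - Q.f h k * P.a i q)) * P.e q j := by
    rw [← P.a_e]
    simp only [Finset.mul_sum, Finset.sum_mul, Finset.smul_sum, ← Finset.sum_add_distrib]
    refine Finset.sum_congr rfl fun q _ => ?_
    simp only [mul_add, sub_mul, mul_smul_comm, smul_mul_assoc, mul_assoc]
    module
  have h2 : ∑ q, (x • (P.a i q * Q.f h k - Q.f h k * P.a i q)) * P.e q j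
      = y • (if k = i then ∑ r, (P.f h r - Q.f h r) * P.b r j else 0) := by
    simp only [H.a_f, smul_mul_assoc, ← Finset.smul_sum]
    split_ifs with hk
    · congr 1
      simp only [Finset.sum_mul]
      rw [Finset.sum_comm]
      simp only [mul_assoc, ← Finset.mul_sum, P.a_e]
    · simp
  have h3 : ∀ q, P.a i q * (Q.g h j * Q.a' q k) = Q.g h j * (P.a i q * Q.a' q k) := fun q => by
    rw [← mul_assoc, H.a_g hx, mul_assoc]
  have h4 : ∑ q, P.a i q * (P.a' q k * P.g h j) = if k = i then P.g h j else 0 := by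
    simp only [← mul_assoc, ← Finset.sum_mul, P.a_a', ite_mul, one_mul, zero_mul, eq_comm]
  rw [h1, h2, H.b_f]
  simp only [mul_smul_comm, ← Finset.smul_sum, mul_sub, Finset.sum_sub_distrib, h3, h4, sub_mul,
    ← Finset.mul_sum, P.f_b]
  split_ifs <;> module

/-- As `a(v)` commutes with `g(u)`, it is enough to compute `[g(u), b(v)]`, which `g = d - f b`
expands. Both `a_g` and `b_f` are needed with `u` and `v` exchanged, hence the second exchange
hypothesis. -/
theorem g_e (H : Exchange x y P Q) (H' : Exchange (-x) y Q P)
    (hx : ∀ z : R, x • z = 0 → z = 0) (i j : n) (h : m) (k : n) :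
    x • (P.g i j * Q.e h k - Q.e h k * P.g i j)
      = y • (P.g i k * (Q.e h j - P.e h j)) := by
  have hx' : ∀ z : R, (-x) • z = 0 → z = 0 := fun z hz => hx z (by simpa using hz)
  refine congrFun (Q.left_cancel
    (X := fun h => x • (P.g i j * Q.e h k - Q.e h k * P.g i j))
    (Y := fun h => y • (P.g i k * (Q.e h j - P.e h j))) fun h => ?_) h
  have h0 : ∀ k, P.g i k = P.d i k - ∑ q, P.f i q * P.b q k := fun k => by rw [P.f_b]; abel
  have h1 : ∑ q, Q.a h q * (x • (P.g i j * Q.e q k - Q.e q k * P.g i j))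
      = x • (P.g i j * Q.b h k - Q.b h k * P.g i j) := by
    rw [← Q.a_e]
    simp only [Finset.mul_sum, Finset.sum_mul, Finset.smul_sum, ← Finset.sum_sub_distrib]
    refine Finset.sum_congr rfl fun q _ => ?_
    simp only [mul_sub, mul_smul_comm, ← mul_assoc, H'.a_g hx']
  have h2 : x • (P.g i j * Q.b h k - Q.b h k * P.g i j)
      = x • (P.d i j * Q.b h k - Q.b h k * P.d i j)
        - (∑ q, P.f i q * (x • (P.b q j * Q.b h k + Q.b h k * P.b q j))
          + ∑ q, ((-x) • (Q.b h k * P.f i q + P.f i q * Q.b h k)) * P.b q j) := by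
    have : ∑ q, P.f i q * (x • (P.b q j * Q.b h k + Q.b h k * P.b q j))
          + ∑ q, ((-x) • (Q.b h k * P.f i q + P.f i q * Q.b h k)) * P.b q j
        = x • ((∑ q, P.f i q * P.b q j) * Q.b h k - Q.b h k * ∑ q, P.f i q * P.b q j) := by
      simp only [Finset.mul_sum, Finset.sum_mul, Finset.smul_sum, ← Finset.sum_sub_distrib,
        ← Finset.sum_add_distrib]
      refine Finset.sum_congr rfl fun q _ => ?_
      simp only [mul_add, add_mul, mul_smul_comm, smul_mul_assoc, mul_assoc]
      module
    rw [this, h0]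
    simp only [mul_sub, sub_mul]
    module
  -- The primed relation keeps the summed index `q` in the left factor, next to `f`, so that `f(u)
  -- b(u)` contracts to `d(u) - g(u)`.
  have h3 : ∑ q, P.f i q * (x • (P.b q j * Q.b h k + Q.b h k * P.b q j))
      = y • ((P.d i k - P.g i k) * Q.b h j - (∑ q, P.f i q * Q.b q k) * P.b h j) := by
    simp only [H.bb', ← P.f_b, Finset.sum_mul, Finset.smul_sum, ← Finset.sum_sub_distrib, mul_sub,
      mul_smul_comm, mul_assoc]
  have h4 : ∑ q, ((-x) • (Q.b h k * P.f i q + P.f i q * Q.b h k)) * P.b q j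
      = y • ((∑ q, P.f i q * Q.b q k - Q.d i k) * P.b h j
        + P.g i k * ∑ q, Q.a h q * P.e q j) := by
    have h5 : ∑ q, (∑ r, Q.a h r * P.a' r q) * P.b q j = ∑ r, Q.a h r * P.e r j := by
      simp only [Finset.sum_mul]
      rw [Finset.sum_comm]
      refine Finset.sum_congr rfl fun r _ => ?_
      simp only [mul_assoc, ← Finset.mul_sum]
      congr 1
      simp only [← P.a_e, Finset.mul_sum]
      rw [Finset.sum_comm]
      simp only [← mul_assoc, ← Finset.sum_mul, P.a'_a]
      simp
    simp only [H'.b_f, smul_mul_assoc, add_mul, ← Finset.smul_sum, Finset.sum_add_distrib, ite_mul,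
      zero_mul, Finset.sum_ite_eq', Finset.mem_univ, if_true]
    simp only [mul_assoc, ← Finset.mul_sum, h5]
  have h6 : ∀ q, Q.a h q * (P.g i k * (Q.e q j - P.e q j))
      = P.g i k * (Q.a h q * Q.e q j) - P.g i k * (Q.a h q * P.e q j) := fun q => by
    rw [← mul_assoc, H'.a_g hx', mul_assoc, mul_sub, mul_sub]
  rw [h1, h2, h3, h4, H.db']
  simp only [mul_smul_comm, ← Finset.smul_sum, h6, Finset.sum_sub_distrib, ← Finset.mul_sum, Q.a_e,
    sub_mul]
  module

/-- The counterpart of `b_f` for the other expansion `g = d - c e`, on which `g_f` rests. -/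
theorem e_c (H : Exchange x y P Q) (i : m) (j h : n) (k : m) :
    x • (P.e i j * Q.c h k + Q.c h k * P.e i j)
      = y • ((if i = k then Q.d h j - ∑ q, Q.c h q * P.e q j else 0)
        - (∑ q, P.a' i q * Q.a q k) * P.g h j) := by
  refine congrFun (P.left_cancel
    (X := fun i => x • (P.e i j * Q.c h k + Q.c h k * P.e i j))
    (Y := fun i => y • ((if i = k then Q.d h j - ∑ q, Q.c h q * P.e q j else 0)
        - (∑ q, P.a' i q * Q.a q k) * P.g h j)) fun i => ?_) i
  have h1 : ∑ q, P.a i q * (x • (P.e q j * Q.c h k + Q.c h k * P.e q j))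
      = x • (P.b i j * Q.c h k + Q.c h k * P.b i j)
        + ∑ q, (x • (P.a i q * Q.c h k - Q.c h k * P.a i q)) * P.e q j := by
    rw [← P.a_e]
    simp only [Finset.mul_sum, Finset.sum_mul, Finset.smul_sum, ← Finset.sum_add_distrib]
    refine Finset.sum_congr rfl fun q _ => ?_
    simp only [mul_add, sub_mul, mul_smul_comm, smul_mul_assoc, mul_assoc]
    module
  have h2 : ∑ q, (x • (P.a i q * Q.c h k - Q.c h k * P.a i q)) * P.e q j
      = y • (Q.a i k * (P.d h j - P.g h j) - P.a i k * ∑ q, Q.c h q * P.e q j) := by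
    simp only [H.ac', ← P.c_e, Finset.mul_sum, Finset.smul_sum, ← Finset.sum_sub_distrib, sub_mul,
      smul_mul_assoc, mul_assoc]
  have h3 : ∑ r, P.a i r * ∑ q, P.a' r q * Q.a q k = Q.a i k := by
    simp only [Finset.mul_sum]
    rw [Finset.sum_comm]
    simp only [← mul_assoc, ← Finset.sum_mul, P.a_a']
    simp
  rw [h1, h2, H.bc']
  simp only [mul_smul_comm, mul_sub, ← Finset.smul_sum, Finset.sum_sub_distrib, mul_ite, mul_zero,
    Finset.sum_ite_eq', Finset.mem_univ, if_true]
  simp only [← mul_assoc, ← Finset.sum_mul, h3]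
  module

/-- As in `g_e`, with sides reversed: `a(v)` is cancelled on the right and `g = d - c e` reduces
`[g, c]` to the brackets of `c` with `d`, `e` and `c`. -/
theorem g_f (H : Exchange x y P Q) (H' : Exchange (-x) y Q P)
    (hx : ∀ z : R, x • z = 0 → z = 0) (i j h : n) (k : m) :
    x • (P.g i j * Q.f h k - Q.f h k * P.g i j)
      = y • ((P.f i k - Q.f i k) * P.g h j) := by
  have hx' : ∀ z : R, (-x) • z = 0 → z = 0 := fun z hz => hx z (by simpa using hz)
  refine congrFun (Q.right_cancel
    (X := fun k => x • (P.g i j * Q.f h k - Q.f h k * P.g i j))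
    (Y := fun k => y • ((P.f i k - Q.f i k) * P.g h j)) fun k => ?_) k
  have h0 : ∀ k, P.g i k = P.d i k - ∑ q, P.c i q * P.e q k := fun k => by rw [P.c_e]; abel
  have h1 : ∑ q, (x • (P.g i j * Q.f h q - Q.f h q * P.g i j)) * Q.a q k
      = x • (P.g i j * Q.c h k - Q.c h k * P.g i j) := by
    rw [← Q.f_a]
    simp only [Finset.mul_sum, Finset.sum_mul, Finset.smul_sum, ← Finset.sum_sub_distrib]
    refine Finset.sum_congr rfl fun q _ => ?_
    simp only [sub_mul, smul_mul_assoc, mul_assoc, H'.a_g hx']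
  have h2 : x • (P.g i j * Q.c h k - Q.c h k * P.g i j)
      = x • (P.d i j * Q.c h k - Q.c h k * P.d i j)
        - (∑ q, P.c i q * (x • (P.e q j * Q.c h k + Q.c h k * P.e q j))
          - ∑ q, (x • (P.c i q * Q.c h k + Q.c h k * P.c i q)) * P.e q j) := by
    have : ∑ q, P.c i q * (x • (P.e q j * Q.c h k + Q.c h k * P.e q j))
          - ∑ q, (x • (P.c i q * Q.c h k + Q.c h k * P.c i q)) * P.e q j
        = x • ((∑ q, P.c i q * P.e q j) * Q.c h k - Q.c h k * ∑ q, P.c i q * P.e q j) := by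
      simp only [Finset.mul_sum, Finset.sum_mul, Finset.smul_sum, ← Finset.sum_sub_distrib]
      refine Finset.sum_congr rfl fun q _ => ?_
      simp only [mul_add, add_mul, mul_smul_comm, smul_mul_assoc, mul_assoc]
      module
    rw [this, h0]
    simp only [mul_sub, sub_mul]
    module
  have h3 : ∑ q, (x • (P.c i q * Q.c h k + Q.c h k * P.c i q)) * P.e q j
      = y • (Q.c i k * (P.d h j - P.g h j) - P.c i k * ∑ q, Q.c h q * P.e q j) := by
    simp only [H.cc', ← P.c_e, Finset.mul_sum, Finset.smul_sum, ← Finset.sum_sub_distrib, sub_mul,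
      smul_mul_assoc, mul_assoc]
  have h4 : ∑ q, P.c i q * (x • (P.e q j * Q.c h k + Q.c h k * P.e q j))
      = y • (P.c i k * (Q.d h j - ∑ q, Q.c h q * P.e q j)
        - (∑ q, P.f i q * Q.a q k) * P.g h j) := by
    have h5 : ∑ q, P.c i q * ∑ r, P.a' q r * Q.a r k = ∑ r, P.f i r * Q.a r k := by
      simp only [Finset.mul_sum]
      rw [Finset.sum_comm]
      refine Finset.sum_congr rfl fun r _ => ?_
      simp only [← mul_assoc, ← Finset.sum_mul]
      congr 1
      simp only [← P.f_a, Finset.sum_mul]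
      rw [Finset.sum_comm]
      simp only [mul_assoc, ← Finset.mul_sum, P.a_a']
      simp
    simp only [H.e_c, mul_smul_comm, mul_sub, ← Finset.smul_sum, Finset.sum_sub_distrib, mul_ite,
      mul_zero, Finset.sum_ite_eq', Finset.mem_univ, if_true]
    simp only [← mul_assoc, ← Finset.sum_mul, h5]
  have h6 : ∀ q, (P.f i q - Q.f i q) * P.g h j * Q.a q k
      = (P.f i q * Q.a q k) * P.g h j - (Q.f i q * Q.a q k) * P.g h j := fun q => by
    rw [mul_assoc, ← H'.a_g hx', ← mul_assoc, sub_mul, sub_mul]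
  rw [h1, h2, h3, h4, H.dc']
  simp only [smul_mul_assoc, ← Finset.smul_sum, h6, Finset.sum_sub_distrib, ← Finset.sum_mul, Q.f_a,
    mul_sub]
  module

/-! ### Towards the relations between two factors `e` or two factors `f` -/

theorem b_e (H : Exchange x y P Q) (i : m) (j : n) (h : m) (k : n) :
    x • (P.b i j * Q.e h k + Q.e h k * P.b i j)
      = y • (Q.e h j * ∑ q, P.a i q * (Q.e q k - P.e q k)) := by
  refine congrFun (Q.left_cancel
    (X := fun h => x • (P.b i j * Q.e h k + Q.e h k * P.b i j))
    (Y := fun h => y • (Q.e h j * ∑ q, P.a i q * (Q.e q k - P.e q k))) fun h => ?_) h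
  have h1 : ∑ q, Q.a h q * (x • (P.b i j * Q.e q k + Q.e q k * P.b i j))
      = x • (P.b i j * Q.b h k + Q.b h k * P.b i j)
        - ∑ q, (x • (P.b i j * Q.a h q - Q.a h q * P.b i j)) * Q.e q k := by
    rw [← Q.a_e]
    simp only [Finset.mul_sum, Finset.sum_mul, Finset.smul_sum, ← Finset.sum_sub_distrib,
      ← Finset.sum_add_distrib]
    refine Finset.sum_congr rfl fun q _ => ?_
    simp only [mul_add, sub_mul, mul_smul_comm, smul_mul_assoc, mul_assoc]
    module
  have h2 : ∑ q, (x • (P.b i j * Q.a h q - Q.a h q * P.b i j)) * Q.e q k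
      = y • (P.b h j * Q.b i k - Q.b h j * ∑ q, P.a i q * Q.e q k) := by
    simp only [H.ba, ← Q.a_e i, Finset.mul_sum, Finset.smul_sum, ← Finset.sum_sub_distrib, sub_mul,
      smul_mul_assoc, mul_assoc]
  rw [h1, h2, H.bb]
  simp only [mul_smul_comm, ← Finset.smul_sum, ← mul_assoc, ← Finset.sum_mul, Q.a_e, mul_sub,
    Finset.sum_sub_distrib, P.a_e]
  module

theorem c_f (H : Exchange x y P Q) (i : n) (j : m) (h : n) (k : m) :
    x • (P.c i j * Q.f h k + Q.f h k * P.c i j)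
      = y • -((∑ q, (P.f h q - Q.f h q) * P.a q j) * Q.f i k) := by
  refine congrFun (Q.right_cancel
    (X := fun k => x • (P.c i j * Q.f h k + Q.f h k * P.c i j))
    (Y := fun k => y • -((∑ q, (P.f h q - Q.f h q) * P.a q j) * Q.f i k)) fun k => ?_) k
  have h1 : ∑ q, (x • (P.c i j * Q.f h q + Q.f h q * P.c i j)) * Q.a q k
      = x • (P.c i j * Q.c h k + Q.c h k * P.c i j)
        + ∑ q, Q.f h q * (x • (P.c i j * Q.a q k - Q.a q k * P.c i j)) := by
    rw [← Q.f_a]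
    simp only [Finset.mul_sum, Finset.sum_mul, Finset.smul_sum, ← Finset.sum_add_distrib]
    refine Finset.sum_congr rfl fun q _ => ?_
    simp only [mul_sub, add_mul, mul_smul_comm, smul_mul_assoc, mul_assoc]
    module
  have h2 : ∑ q, Q.f h q * (x • (P.c i j * Q.a q k - Q.a q k * P.c i j))
      = y • ((∑ q, Q.f h q * P.a q j) * Q.c i k - Q.c h j * P.c i k) := by
    simp only [H.ca, ← Q.f_a h, Finset.sum_mul, Finset.smul_sum, ← Finset.sum_sub_distrib, mul_sub,
      mul_smul_comm, mul_assoc]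
  rw [h1, h2, H.cc]
  simp only [smul_mul_assoc, neg_mul, mul_assoc, ← Finset.smul_sum, Finset.sum_neg_distrib,
    ← Finset.mul_sum, Q.f_a]
  simp only [sub_mul, Finset.sum_sub_distrib, P.f_a]
  module

/-- The deviation of `e`, `e` from the expected relation. -/
theorem e_e_aux (H : Exchange x y P Q) (i : m) (j : n) (h : m) (k : n) :
    x • (x • (P.e i j * Q.e h k + Q.e h k * P.e i j)
        - y • ((P.e i k - Q.e i k) * (Q.e h j - P.e h j)))
      + y • (x • (P.e i k * Q.e h j + Q.e h j * P.e i k)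
        - y • ((P.e i j - Q.e i j) * (Q.e h k - P.e h k)))
      = x • y • (Q.e h j * Q.e i k + Q.e i k * Q.e h j) := by
  -- Two factors `x` are needed: the first converts the brackets of `e(v)` with `b(u)` and `a(u)`,
  -- the second carries the `e(v)` produced by `b_e` past `a(u)`, so that `a(u)` stands on the left
  -- and cancels.
  have main : x • x • (P.e i j * Q.e h k + Q.e h k * P.e i j)
      = y • (x • (Q.e h j * (Q.e i k - P.e i k)) + x • ((Q.e i k - P.e i k) * P.e h j)
        - y • ((Q.e i j - P.e i j) * (Q.e h k - P.e h k))) := by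
    refine congrFun (P.left_cancel
      (X := fun i => x • x • (P.e i j * Q.e h k + Q.e h k * P.e i j))
      (Y := fun i => y • (x • (Q.e h j * (Q.e i k - P.e i k)) + x • ((Q.e i k - P.e i k) * P.e h j)
        - y • ((Q.e i j - P.e i j) * (Q.e h k - P.e h k)))) fun i => ?_) i
    have h1 : ∑ q, P.a i q * (x • x • (P.e q j * Q.e h k + Q.e h k * P.e q j))
        = x • (x • (P.b i j * Q.e h k + Q.e h k * P.b i j)
          + ∑ q, (x • (P.a i q * Q.e h k - Q.e h k * P.a i q)) * P.e q j) := by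
      rw [← P.a_e]
      simp only [Finset.mul_sum, Finset.sum_mul, Finset.smul_sum, ← Finset.sum_add_distrib]
      refine Finset.sum_congr rfl fun q _ => ?_
      simp only [mul_add, sub_mul, mul_smul_comm, smul_mul_assoc, mul_assoc]
      module
    have h2 : ∑ q, (x • (P.a i q * Q.e h k - Q.e h k * P.a i q)) * P.e q j
        = y • ∑ q, P.a i q * ((Q.e q k - P.e q k) * P.e h j) := by
      simp only [H.a_e, smul_mul_assoc, ite_mul, zero_mul, ← Finset.smul_sum, Finset.sum_ite_eq,
        Finset.mem_univ, if_true, Finset.sum_mul, mul_assoc]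
    have h3 : x • (Q.e h j * ∑ q, P.a i q * (Q.e q k - P.e q k))
        = x • (∑ q, P.a i q * (Q.e h j * (Q.e q k - P.e q k)))
          - ∑ q, (x • (P.a i q * Q.e h j - Q.e h j * P.a i q)) * (Q.e q k - P.e q k) := by
      simp only [Finset.mul_sum, Finset.smul_sum, ← Finset.sum_sub_distrib]
      refine Finset.sum_congr rfl fun q _ => ?_
      simp only [mul_sub, sub_mul, mul_assoc, smul_mul_assoc]
      module
    have h4 : ∑ q, (x • (P.a i q * Q.e h j - Q.e h j * P.a i q)) * (Q.e q k - P.e q k)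
        = y • ∑ q, P.a i q * ((Q.e q j - P.e q j) * (Q.e h k - P.e h k)) := by
      simp only [H.a_e, smul_mul_assoc, ite_mul, zero_mul, ← Finset.smul_sum, Finset.sum_ite_eq,
        Finset.mem_univ, if_true, Finset.sum_mul, mul_assoc]
    rw [h1, h2, H.b_e, ← smul_add, smul_comm x y, smul_add, h3, h4]
    simp only [mul_sub, mul_add, mul_smul_comm, Finset.sum_sub_distrib, Finset.sum_add_distrib,
      ← Finset.smul_sum]
    module
  simp only [smul_sub, main]
  simp only [mul_sub, sub_mul]
  module

/-- The mirror image of `e_e_aux`: `a(u)` is cancelled on the right, and the second deviation has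
the row indices `i`, `h` exchanged instead of the columns. -/
theorem f_f_aux (H : Exchange x y P Q) (i : n) (j : m) (h : n) (k : m) :
    x • (x • (P.f i j * Q.f h k + Q.f h k * P.f i j)
        - y • ((P.f i k - Q.f i k) * (Q.f h j - P.f h j)))
      + y • (x • (P.f h j * Q.f i k + Q.f i k * P.f h j)
        - y • ((P.f h k - Q.f h k) * (Q.f i j - P.f i j)))
      = x • y • (Q.f h j * Q.f i k + Q.f i k * Q.f h j) := by
  have main : x • x • (P.f i j * Q.f h k + Q.f h k * P.f i j)
      = y • (-(x • ((P.f h j - Q.f h j) * Q.f i k)) - x • (P.f i k * (P.f h j - Q.f h j))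
        - y • ((P.f h k - Q.f h k) * (P.f i j - Q.f i j))) := by
    refine congrFun (P.right_cancel
      (X := fun j => x • x • (P.f i j * Q.f h k + Q.f h k * P.f i j))
      (Y := fun j => y • (-(x • ((P.f h j - Q.f h j) * Q.f i k))
        - x • (P.f i k * (P.f h j - Q.f h j))
        - y • ((P.f h k - Q.f h k) * (P.f i j - Q.f i j)))) fun j => ?_) j
    have h1 : ∑ q, (x • x • (P.f i q * Q.f h k + Q.f h k * P.f i q)) * P.a q j
        = x • (x • (P.c i j * Q.f h k + Q.f h k * P.c i j)
          - ∑ q, P.f i q * (x • (P.a q j * Q.f h k - Q.f h k * P.a q j))) := by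
      rw [← P.f_a]
      simp only [Finset.mul_sum, Finset.sum_mul, Finset.smul_sum, ← Finset.sum_sub_distrib,
        ← Finset.sum_add_distrib]
      refine Finset.sum_congr rfl fun q _ => ?_
      simp only [add_mul, mul_sub, mul_smul_comm, smul_mul_assoc, mul_assoc]
      module
    have h2 : ∑ q, P.f i q * (x • (P.a q j * Q.f h k - Q.f h k * P.a q j))
        = y • ∑ q, P.f i k * ((P.f h q - Q.f h q) * P.a q j) := by
      simp only [H.a_f, mul_smul_comm, mul_ite, mul_zero, ← Finset.smul_sum, Finset.sum_ite_eq,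
        Finset.mem_univ, if_true, Finset.mul_sum]
    have h3 : x • ((∑ q, (P.f h q - Q.f h q) * P.a q j) * Q.f i k)
        = x • (∑ q, (P.f h q - Q.f h q) * (Q.f i k * P.a q j))
          + ∑ q, (P.f h q - Q.f h q) * (x • (P.a q j * Q.f i k - Q.f i k * P.a q j)) := by
      simp only [Finset.sum_mul, Finset.smul_sum, ← Finset.sum_add_distrib]
      refine Finset.sum_congr rfl fun q _ => ?_
      simp only [mul_sub, sub_mul, mul_assoc, mul_smul_comm]
      module
    have h4 : ∑ q, (P.f h q - Q.f h q) * (x • (P.a q j * Q.f i k - Q.f i k * P.a q j))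
        = y • ∑ q, (P.f h k - Q.f h k) * ((P.f i q - Q.f i q) * P.a q j) := by
      simp only [H.a_f, mul_smul_comm, mul_ite, mul_zero, ← Finset.smul_sum, Finset.sum_ite_eq,
        Finset.mem_univ, if_true, Finset.mul_sum]
    rw [h1, h2, H.c_f, smul_neg, ← neg_add', smul_neg, ← smul_add, smul_comm x y, smul_add, h3, h4]
    simp only [sub_mul, neg_mul, smul_mul_assoc, Finset.sum_sub_distrib, mul_assoc,
      ← Finset.smul_sum, Finset.sum_neg_distrib, mul_sub]
    module
  simp only [smul_sub, main]
  simp only [mul_sub, sub_mul]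
  module

end Exchange

/-! ### Exchange relations from the defining relations -/

/-- A ring homomorphism applied to all the blocks. -/
def GaussBlocks.map {m n R S : Type*} [Fintype m] [DecidableEq m] [Ring R] [Ring S]
    (P : GaussBlocks m n R) (φ : R →+* S) : GaussBlocks m n S where
  a i j := φ (P.a i j)
  a' i j := φ (P.a' i j)
  b i j := φ (P.b i j)
  c i j := φ (P.c i j)
  d i j := φ (P.d i j)
  e i j := φ (P.e i j)
  f i j := φ (P.f i j)
  g i j := φ (P.g i j)
  a_a' i k := by
    simp only [← map_mul, ← map_sum, P.a_a']
    split_ifs <;> simp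
  a'_a i k := by
    simp only [← map_mul, ← map_sum, P.a'_a]
    split_ifs <;> simp
  a_e i k := by simp only [← map_mul, ← map_sum, P.a_e]
  f_a i k := by simp only [← map_mul, ← map_sum, P.f_a]
  f_b i k := by simp only [← map_mul, ← map_sum, ← map_sub, P.f_b]
  c_e i k := by simp only [← map_mul, ← map_sum, ← map_sub, P.c_e]

/-- The matrix with the given blocks. -/
def GaussBlocks.mat {M N : ℕ} {R : Type*} [Ring R] (P : GaussBlocks (Fin M) (Fin N) R) :
    Idx M N → Idx M N → R
  | Sum.inl i, Sum.inl j => P.a i j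
  | Sum.inl i, Sum.inr j => P.b i j
  | Sum.inr i, Sum.inl j => P.c i j
  | Sum.inr i, Sum.inr j => P.d i j

/-- The exchange relation of the super Yangian, with `x : y` in the role of `u - v : 1`. -/
def SuperExchange {M N : ℕ} {K R : Type*} [CommRing K] [Ring R] [Algebra K R] (x y : K)
    (t t' : Idx M N → Idx M N → R) : Prop :=
  ∀ i j h k, x • (t i j * t' h k
      - (-1 : ℤ) ^ ((par i + par j) * (par h + par k)) • (t' h k * t i j))
    = y • ((-1 : ℤ) ^ (par i * par j + par i * par h + par j * par h) •
      (t h j * t' i k - t' h j * t i k))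

/-- Each relation is one choice of the four parities. The primed ones come from the relation with
`u` and `v` exchanged, applied to the index pairs in the opposite order: the bracket changes at most
by a sign and the products on the right are reversed. -/
theorem SuperExchange.exchange {M N : ℕ} {K R : Type*} [CommRing K] [Ring R] [Algebra K R]
    {x y : K} {P Q : GaussBlocks (Fin M) (Fin N) R} (H : SuperExchange x y P.mat Q.mat)
    (H' : SuperExchange (-x) y Q.mat P.mat) : Exchange x y P Q where
  aa i j h k := by simpa [par, GaussBlocks.mat] using H (.inl i) (.inl j) (.inl h) (.inl k)
  ab i j h k := by simpa [par, GaussBlocks.mat] using H (.inl i) (.inl j) (.inl h) (.inr k)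
  ac i j h k := by simpa [par, GaussBlocks.mat] using H (.inl i) (.inl j) (.inr h) (.inl k)
  ad i j h k := by simpa [par, GaussBlocks.mat] using H (.inl i) (.inl j) (.inr h) (.inr k)
  ba i j h k := by simpa [par, GaussBlocks.mat] using H (.inl i) (.inr j) (.inl h) (.inl k)
  ca i j h k := by simpa [par, GaussBlocks.mat] using H (.inr i) (.inl j) (.inl h) (.inl k)
  bb i j h k := by simpa [par, GaussBlocks.mat] using H (.inl i) (.inr j) (.inl h) (.inr k)
  bc i j h k := by simpa [par, GaussBlocks.mat] using H (.inl i) (.inr j) (.inr h) (.inl k)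
  cc i j h k := by simpa [par, GaussBlocks.mat] using H (.inr i) (.inl j) (.inr h) (.inl k)
  ac' i j h k := by
    have := H' (.inr h) (.inl k) (.inl i) (.inl j)
    simp only [par, GaussBlocks.mat] at this
    linear_combination (norm := module) this
  bb' i j h k := by
    have := H' (.inl h) (.inr k) (.inl i) (.inr j)
    simp only [par, GaussBlocks.mat] at this
    linear_combination (norm := module) (-1 : K) • this
  bc' i j h k := by
    have := H' (.inr h) (.inl k) (.inl i) (.inr j)
    simp only [par, GaussBlocks.mat] at this
    linear_combination (norm := module) (-1 : K) • this
  cc' i j h k := by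
    have := H' (.inr h) (.inl k) (.inr i) (.inl j)
    simp only [par, GaussBlocks.mat] at this
    linear_combination (norm := module) (-1 : K) • this
  db' i j h k := by
    have := H' (.inl h) (.inr k) (.inr i) (.inr j)
    simp only [par, GaussBlocks.mat] at this
    linear_combination (norm := module) this
  dc' i j h k := by
    have := H' (.inr h) (.inl k) (.inr i) (.inr j)
    simp only [par, GaussBlocks.mat] at this
    linear_combination (norm := module) this

/-- The supercommutator of two generators, with an integral sign. -/
def genBracket {M N : ℕ} (i j h k : Idx M N) (r s : ℕ) : Yangian M N :=
  t i j r * t h k s - (-1 : ℤ) ^ ((par i + par j) * (par h + par k)) • (t h k s * t i j r)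

/-- Integral signs make sense in every ring, so `SuperExchange` can be stated without scalars from
`ℂ`. -/
theorem neg_one_pow_smul {V : Type*} [AddCommGroup V] [Module ℂ V] (n : ℕ) (z : V) :
    (-1 : ℂ) ^ n • z = (-1 : ℤ) ^ n • z := by
  rcases neg_one_pow_eq_or ℤ n with h | h <;> rcases n.even_or_odd with h' | h' <;>
    simp [h'.neg_one_pow]

theorem genBracket_eq {M N : ℕ} (i j h k : Idx M N) (r s : ℕ) :
    genBracket i j h k r s = (-1 : ℤ) ^ (par i * par j + par i * par h + par j * par h) •
      ∑ x ∈ Finset.range (min r s),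
        (t h j x * t i k (r + s - 1 - x) - t h j (r + s - 1 - x) * t i k x) := by
  rw [genBracket, ← neg_one_pow_smul, ← neg_one_pow_smul, t_comm]

theorem genBracket_zero_left {M N : ℕ} (i j h k : Idx M N) (s : ℕ) :
    genBracket i j h k 0 s = 0 := by simp [genBracket_eq]

theorem genBracket_zero_right {M N : ℕ} (i j h k : Idx M N) (r : ℕ) :
    genBracket i j h k r 0 = 0 := by simp [genBracket_eq]

/-- Telescoping: both sums have the same summands, over ranges of length `min (r + 1) s` and `min r
(s + 1)`. These differ by one term, on one side if `r < s` and on the other if `s < r`; for `r = s`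
both sides vanish. -/
theorem genBracket_succ {M N : ℕ} (i j h k : Idx M N) (r s : ℕ) :
    genBracket i j h k (r + 1) s - genBracket i j h k r (s + 1)
      = (-1 : ℤ) ^ (par i * par j + par i * par h + par j * par h) •
        (t h j r * t i k s - t h j s * t i k r) := by
  rw [genBracket_eq, genBracket_eq, ← smul_sub]
  congr 1
  rw [show r + 1 + s - 1 = r + s by omega, show r + (s + 1) - 1 = r + s by omega]
  rcases lt_trichotomy r s with hrs | rfl | hrs
  · rw [min_eq_left (by omega : r + 1 ≤ s), min_eq_left (by omega : r ≤ s + 1),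
      Finset.sum_range_succ, add_sub_cancel_left, Nat.add_sub_cancel_left]
  · simp
  · rw [min_eq_right (by omega : s ≤ r + 1), min_eq_right (by omega : s + 1 ≤ r),
      Finset.sum_range_succ, Nat.add_sub_cancel]
    abel

/-! ### Coefficients of series in two variables -/

/-- The coefficient of `u^{-r} v^{-s}`. -/
def coeffUV {M N : ℕ} (r s : ℕ) : Ser M N →+ Yangian M N :=
  (MvPowerSeries.coeff (Finsupp.single 0 r + Finsupp.single 1 s)).toAddMonoidHom

theorem single_add_single_eq (n : Fin 2 →₀ ℕ) :
    Finsupp.single 0 (n 0) + Finsupp.single 1 (n 1) = n := by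
  ext i
  fin_cases i <;> simp

theorem coeffUV_apply {M N : ℕ} (f : Ser M N) (r s : ℕ) :
    coeffUV r s f = f (Finsupp.single 0 r + Finsupp.single 1 s) := rfl

theorem ext_coeffUV {M N : ℕ} {f g : Ser M N} (h : ∀ r s, coeffUV r s f = coeffUV r s g) :
    f = g := by
  funext n
  have := h (n 0) (n 1)
  rwa [coeffUV_apply, coeffUV_apply, single_add_single_eq] at this

theorem X_smul {M N : ℕ} (p : Fin 2) (f : Ser M N) :
    (MvPowerSeries.X p : MvPowerSeries (Fin 2) ℂ) • f = MvPowerSeries.X p * f := by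
  rw [Algebra.smul_def]
  congr 1
  exact MvPowerSeries.map_X _ _

theorem coeff_X_smul {M N : ℕ} (p : Fin 2) (f : Ser M N) (n : Fin 2 →₀ ℕ) :
    MvPowerSeries.coeff n ((MvPowerSeries.X p : MvPowerSeries (Fin 2) ℂ) • f)
      = if n p = 0 then 0 else MvPowerSeries.coeff (n - Finsupp.single p 1) f := by
  rw [X_smul, MvPowerSeries.X_def, MvPowerSeries.coeff_monomial_mul]
  simp only [Finsupp.single_le_iff, one_mul, Nat.one_le_iff_ne_zero, ite_not]

theorem coeffUV_X0_succ {M N : ℕ} (f : Ser M N) (r s : ℕ) :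
    coeffUV (r + 1) s ((MvPowerSeries.X 0 : MvPowerSeries (Fin 2) ℂ) • f) = coeffUV r s f := by
  refine (coeff_X_smul 0 f _).trans ?_
  rw [if_neg (by simp)]
  change f _ = f _
  congr 1
  ext i
  fin_cases i <;> simp

theorem coeffUV_X0_zero {M N : ℕ} (f : Ser M N) (s : ℕ) :
    coeffUV 0 s ((MvPowerSeries.X 0 : MvPowerSeries (Fin 2) ℂ) • f) = 0 := by
  refine (coeff_X_smul 0 f _).trans ?_
  rw [if_pos (by simp)]

theorem coeffUV_X1_succ {M N : ℕ} (f : Ser M N) (r s : ℕ) :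
    coeffUV r (s + 1) ((MvPowerSeries.X 1 : MvPowerSeries (Fin 2) ℂ) • f) = coeffUV r s f := by
  refine (coeff_X_smul 1 f _).trans ?_
  rw [if_neg (by simp)]
  change f _ = f _
  congr 1
  ext i
  fin_cases i <;> simp

theorem coeffUV_X1_zero {M N : ℕ} (f : Ser M N) (r : ℕ) :
    coeffUV r 0 ((MvPowerSeries.X 1 : MvPowerSeries (Fin 2) ℂ) • f) = 0 := by
  refine (coeff_X_smul 1 f _).trans ?_
  rw [if_pos (by simp)]

/-- The numerator of `u - v = (v⁻¹ - u⁻¹) / (u⁻¹ v⁻¹)`. -/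
def numUV : MvPowerSeries (Fin 2) ℂ := MvPowerSeries.X 1 - MvPowerSeries.X 0

/-- The denominator of `u - v = (v⁻¹ - u⁻¹) / (u⁻¹ v⁻¹)`. -/
def denUV : MvPowerSeries (Fin 2) ℂ := MvPowerSeries.X 0 * MvPowerSeries.X 1

theorem coeffUV_num_succ_succ {M N : ℕ} (f : Ser M N) (r s : ℕ) :
    coeffUV (r + 1) (s + 1) (numUV • f) = coeffUV (r + 1) s f - coeffUV r (s + 1) f := by
  rw [numUV, sub_smul, map_sub, coeffUV_X0_succ, coeffUV_X1_succ]

theorem coeffUV_num_zero_succ {M N : ℕ} (f : Ser M N) (s : ℕ) :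
    coeffUV 0 (s + 1) (numUV • f) = coeffUV 0 s f := by
  rw [numUV, sub_smul, map_sub, coeffUV_X0_zero, coeffUV_X1_succ, sub_zero]

theorem coeffUV_num_succ_zero {M N : ℕ} (f : Ser M N) (r : ℕ) :
    coeffUV (r + 1) 0 (numUV • f) = -coeffUV r 0 f := by
  rw [numUV, sub_smul, map_sub, coeffUV_X0_succ, coeffUV_X1_zero, zero_sub]

theorem coeffUV_num_zero_zero {M N : ℕ} (f : Ser M N) : coeffUV 0 0 (numUV • f) = 0 := by
  rw [numUV, sub_smul, map_sub, coeffUV_X0_zero, coeffUV_X1_zero, sub_zero]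

theorem coeffUV_den_succ_succ {M N : ℕ} (f : Ser M N) (r s : ℕ) :
    coeffUV (r + 1) (s + 1) (denUV • f) = coeffUV r s f := by
  rw [denUV, mul_smul, coeffUV_X0_succ, coeffUV_X1_succ]

theorem coeffUV_den_zero_left {M N : ℕ} (f : Ser M N) (s : ℕ) :
    coeffUV 0 s (denUV • f) = 0 := by
  rw [denUV, mul_smul, coeffUV_X0_zero]

theorem coeffUV_den_zero_right {M N : ℕ} (f : Ser M N) (r : ℕ) :
    coeffUV r 0 (denUV • f) = 0 := by
  rw [denUV, mul_comm, mul_smul, coeffUV_X1_zero]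

/-- The equation `(u - v) f = g` read off coefficientwise; the two vanishing conditions say that `(u
- v) f` has no terms with a positive power of `u` or `v`. -/
theorem num_smul_eq_den_smul_iff {M N : ℕ} (f g : Ser M N) :
    numUV • f = denUV • g ↔ (∀ s, coeffUV 0 s f = 0) ∧ (∀ r, coeffUV r 0 f = 0) ∧
      ∀ r s, coeffUV (r + 1) s f - coeffUV r (s + 1) f = coeffUV r s g := by
  constructor
  · intro h
    refine ⟨fun s => ?_, fun r => ?_, fun r s => ?_⟩
    · rw [← coeffUV_num_zero_succ, h, coeffUV_den_zero_left]
    · rw [← neg_eq_zero, ← coeffUV_num_succ_zero, h, coeffUV_den_zero_right]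
    · rw [← coeffUV_num_succ_succ, h, coeffUV_den_succ_succ]
  · rintro ⟨h1, h2, h3⟩
    refine ext_coeffUV fun r s => ?_
    rcases r with _ | r <;> rcases s with _ | s
    · rw [coeffUV_num_zero_zero, coeffUV_den_zero_left]
    · rw [coeffUV_num_zero_succ, coeffUV_den_zero_left, h1]
    · rw [coeffUV_num_succ_zero, coeffUV_den_zero_right, h2, neg_zero]
    · rw [coeffUV_num_succ_succ, coeffUV_den_succ_succ, h3]

/-- The coefficient at `(r, s + 1)` equals that at `(r + 1, s)`, so everything moves down to the
vanishing column `s = 0`. -/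
theorem num_smul_eq_zero {M N : ℕ} (f : Ser M N) (h : numUV • f = 0) : f = 0 := by
  rw [← smul_zero denUV, num_smul_eq_den_smul_iff] at h
  obtain ⟨-, h2, h3⟩ := h
  refine ext_coeffUV fun r s => ?_
  rw [map_zero]
  induction s generalizing r with
  | zero => exact h2 r
  | succ s ih =>
    have := h3 r s
    rwa [ih, zero_sub, map_zero, neg_eq_zero] at this

/-- A system of linear equations over two-variable series with only the zero solution. -/
theorem eq_zero_of_num_den {M N : ℕ} {ι : Type*} (σ : ι → ι) (hσ : Function.Involutive σ)
    (Z Q : ι → Ser M N) (hQ : ∀ i r s, coeffUV (r + 1) s (Q i) = 0)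
    (h : ∀ i, numUV • Z i + denUV • Z (σ i) = numUV • denUV • Q i) (i : ι) : Z i = 0 := by
  -- Absorbing the right-hand side leaves `(u - v) (Z i - y Q i) = -Z (σ i)`, to which the
  -- coefficient criterion applies.
  have h' : ∀ i, numUV • (Z i - denUV • Q i) = denUV • (-Z (σ i)) := fun i => by
    rw [smul_sub, ← h i, smul_neg]
    abel
  simp only [num_smul_eq_den_smul_iff, map_sub, map_neg] at h'
  have hl : ∀ i s, coeffUV 0 s (Z i) = 0 := fun i s => by
    have := (h' i).1 s
    rwa [coeffUV_den_zero_left, sub_zero] at this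
  have hr : ∀ i r, coeffUV r 0 (Z i) = 0 := fun i r => by
    have := (h' i).2.1 r
    rwa [coeffUV_den_zero_right, sub_zero] at this
  -- As `Q` is constant in `u`, `y Q` lives only in degree `u⁻¹`. From `u⁻²` on the recurrence is
  -- homogeneous and induction on `s` applies.
  have h2 : ∀ s i r, coeffUV (r + 2) s (Z i) = 0 := fun s => by
    induction s with
    | zero => exact fun i r => hr i _
    | succ s ih =>
      intro i r
      have := (h' i).2.2 (r + 2) s
      have e : ∀ r s, coeffUV (r + 2) s (denUV • Q i) = 0 := fun r s => by
        rcases s with _ | s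
        · exact coeffUV_den_zero_right _ _
        · rw [coeffUV_den_succ_succ, hQ]
      rw [e, show r + 2 + 1 = (r + 1) + 2 by omega, ih, ih, e] at this
      simpa using this
  have h1 : ∀ i s, coeffUV 1 s (Z i) = coeffUV 1 s (denUV • Q i) := fun i s => by
    have := (h' i).2.2 0 s
    rw [hl, hl, coeffUV_den_zero_left, zero_add] at this
    simpa [sub_eq_zero] using this
  -- In row `1` the left side of the recurrence vanishes: `Z i - y Q i` is zero in degree `u⁻¹` by
  -- `h1` and in degree `u⁻²` by `h2`.
  have h1' : ∀ i s, coeffUV 1 s (Z (σ i)) = 0 := fun i s => by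
    have := (h' i).2.2 1 s
    have e : coeffUV 2 s (denUV • Q i) = 0 := by
      rcases s with _ | s
      · exact coeffUV_den_zero_right _ _
      · exact (coeffUV_den_succ_succ _ _ _).trans (hQ _ _ _)
    rw [h1 i, sub_self, h2 s i 0, e] at this
    simpa using this
  refine ext_coeffUV fun r s => ?_
  rw [map_zero]
  rcases r with _ | _ | r
  · exact hl i s
  · rw [← hσ i]; exact h1' _ s
  · exact h2 s i r

/-- The series `A(u)` for `p = 0` and `A(v)` for `p = 1`. -/
def seriesFun {M N : ℕ} (p : Fin 2) (A : PowerSeries (Yangian M N)) : Ser M N :=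
  fun n => if n (1 - p) = 0 then PowerSeries.coeff (n p) A else 0

theorem coeff_seriesFun {M N : ℕ} (p : Fin 2) (A : PowerSeries (Yangian M N)) (n : Fin 2 →₀ ℕ) :
    MvPowerSeries.coeff n (seriesFun p A)
      = if n (1 - p) = 0 then PowerSeries.coeff (n p) A else 0 := rfl

theorem one_sub_ne (p : Fin 2) : 1 - p ≠ p := by fin_cases p <;> simp

/-- `seriesFun` as a ring homomorphism. -/
def seriesIn {M N : ℕ} (p : Fin 2) : PowerSeries (Yangian M N) →+* Ser M N where
  toFun := seriesFun p
  map_zero' := by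
    ext n
    simp [coeff_seriesFun]
  map_add' A B := by
    ext n
    simp only [coeff_seriesFun, map_add]
    split_ifs <;> simp
  map_one' := by
    classical
    ext n
    rw [MvPowerSeries.coeff_one, coeff_seriesFun, PowerSeries.coeff_one, ← ite_and]
    congr 1
    rw [eq_iff_iff, Finsupp.ext_iff]
    fin_cases p <;> simp [and_comm]
  map_mul' A B := by
    classical
    ext n
    rw [MvPowerSeries.coeff_mul]
    simp only [coeff_seriesFun]
    split_ifs with h
    · have hn : n = Finsupp.single p (n p) := by
        ext i
        fin_cases p <;> fin_cases i <;> simp_all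
      rw [PowerSeries.coeff_mul]
      conv_rhs => rw [hn, Finsupp.antidiagonal_single, Finset.sum_map]
      refine Finset.sum_congr rfl fun x _ => ?_
      simp [(one_sub_ne p).symm]
    · refine (Finset.sum_eq_zero fun x hx => ?_).symm
      have hx' : x.1 (1 - p) + x.2 (1 - p) = n (1 - p) := by
        rw [← Finset.HasAntidiagonal.mem_antidiagonal.1 hx]; rfl
      by_cases h1 : x.1 (1 - p) = 0
      · rw [if_neg (show ¬ x.2 (1 - p) = 0 by omega), mul_zero]
      · rw [if_neg h1, zero_mul]

theorem coeff_seriesIn {M N : ℕ} (p : Fin 2) (A : PowerSeries (Yangian M N)) (n : Fin 2 →₀ ℕ) :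
    MvPowerSeries.coeff n (seriesIn p A)
      = if n (1 - p) = 0 then PowerSeries.coeff (n p) A else 0 := rfl

theorem coeffUV_seriesIn_one {M N : ℕ} (A : PowerSeries (Yangian M N)) (r s : ℕ) :
    coeffUV r s (seriesIn 1 A) = if r = 0 then PowerSeries.coeff s A else 0 := by
  change ite _ _ _ = _
  simp

/-- Only one splitting of the exponent has each part supported on its own variable. Allowing both
values of `p` covers both orders of multiplication. -/
theorem coeff_seriesIn_mul {M N : ℕ} (p : Fin 2) (A B : PowerSeries (Yangian M N))
    (n : Fin 2 →₀ ℕ) : MvPowerSeries.coeff n (seriesIn p A * seriesIn (1 - p) B)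
      = PowerSeries.coeff (n p) A * PowerSeries.coeff (n (1 - p)) B := by
  classical
  rw [MvPowerSeries.coeff_mul, Finset.sum_eq_single
    (Finsupp.single p (n p), Finsupp.single (1 - p) (n (1 - p)))]
  · simp [coeff_seriesIn, (one_sub_ne p).symm]
  · intro x hx hne
    rw [coeff_seriesIn, coeff_seriesIn]
    rw [Finset.HasAntidiagonal.mem_antidiagonal] at hx
    split_ifs with h1 h2
    · refine absurd ?_ hne
      subst hx
      ext i <;> fin_cases p <;> fin_cases i <;> simp_all
    all_goals simp
  · intro h
    refine absurd ?_ h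
    rw [Finset.HasAntidiagonal.mem_antidiagonal]
    ext i
    fin_cases p <;> fin_cases i <;> simp

theorem coeffUV_u_mul_v {M N : ℕ} (A B : PowerSeries (Yangian M N)) (r s : ℕ) :
    coeffUV r s (seriesIn 0 A * seriesIn 1 B) = PowerSeries.coeff r A * PowerSeries.coeff s B := by
  refine (coeff_seriesIn_mul 0 A B _).trans ?_
  simp

theorem coeffUV_v_mul_u {M N : ℕ} (A B : PowerSeries (Yangian M N)) (r s : ℕ) :
    coeffUV r s (seriesIn 1 A * seriesIn 0 B) = PowerSeries.coeff s A * PowerSeries.coeff r B := by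
  refine (coeff_seriesIn_mul 1 A B _).trans ?_
  simp


/-! ### The Gauss decomposition of `T(u)` in two variables -/

theorem D₁_mul_D₁' {M N : ℕ} (i k : Fin M) :
    ∑ q, D₁ (N := N) i q * D₁' q k = if i = k then 1 else 0 :=
  (congrFun (congrFun (isUnit_D₁ M N).mul_val_inv i) k).trans Matrix.one_apply

theorem D₁'_mul_D₁ {M N : ℕ} (i k : Fin M) :
    ∑ q, D₁' (N := N) i q * D₁ q k = if i = k then 1 else 0 :=
  (congrFun (congrFun (isUnit_D₁ M N).val_inv_mul i) k).trans Matrix.one_apply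

theorem D₁_mul_E {M N : ℕ} (i : Fin M) (k : Fin N) :
    ∑ q, D₁ i q * E q k = tSeries (Sum.inl i) (Sum.inr k) :=
  (congrFun (congrFun (gauss M N).blocks.2.1 i) k).symm

theorem F_mul_D₁ {M N : ℕ} (i : Fin N) (k : Fin M) :
    ∑ q, F i q * D₁ q k = tSeries (Sum.inr i) (Sum.inl k) :=
  (congrFun (congrFun (gauss M N).blocks.2.2.1 i) k).symm

theorem tSeries_inr_mul_E {M N : ℕ} (i k : Fin N) :
    ∑ q : Fin M, tSeries (Sum.inr i) (Sum.inl q) * E q k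
      = tSeries (Sum.inr i) (Sum.inr k) - D₂ i k := by
  have h : tSeries (Sum.inr i) (Sum.inr k)
      = ((gauss M N).F * (gauss M N).D₁ * (gauss M N).E) i k + D₂ i k :=
    congrFun (congrFun (gauss M N).blocks.2.2.2 i) k
  rw [h, ← (gauss M N).blocks.2.2.1, add_sub_cancel_right]
  rfl

theorem F_mul_tSeries_inl {M N : ℕ} (i k : Fin N) :
    ∑ q : Fin M, F i q * tSeries (Sum.inl q) (Sum.inr k)
      = tSeries (Sum.inr i) (Sum.inr k) - D₂ i k := by
  have h : tSeries (Sum.inr i) (Sum.inr k)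
      = ((gauss M N).F * (gauss M N).D₁ * (gauss M N).E) i k + D₂ i k :=
    congrFun (congrFun (gauss M N).blocks.2.2.2 i) k
  rw [h, Matrix.mul_assoc, ← (gauss M N).blocks.2.1, add_sub_cancel_right]
  rfl

/-- The blocks of `T(u)` and of its Gauss decomposition. -/
def yangianBlocks (M N : ℕ) : GaussBlocks (Fin M) (Fin N) (PowerSeries (Yangian M N)) where
  a := D₁
  a' := D₁'
  b i j := tSeries (Sum.inl i) (Sum.inr j)
  c i j := tSeries (Sum.inr i) (Sum.inl j)
  d i j := tSeries (Sum.inr i) (Sum.inr j)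
  e := E
  f := F
  g := D₂
  a_a' := D₁_mul_D₁'
  a'_a := D₁'_mul_D₁
  a_e := D₁_mul_E
  f_a := F_mul_D₁
  f_b := F_mul_tSeries_inl
  c_e := tSeries_inr_mul_E

theorem mat_map_yangianBlocks {M N : ℕ} (p : Fin 2) :
    ((yangianBlocks M N).map (seriesIn p)).mat = fun i j => seriesIn p (tSeries i j) := by
  funext i j
  rcases i with i | i <;> rcases j with j | j <;> rfl

theorem coeff_tSeries {M N : ℕ} (i j : Idx M N) (r : ℕ) :
    PowerSeries.coeff r (tSeries i j) = t i j r := PowerSeries.coeff_mk _ _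

theorem superExchange_UV (M N : ℕ) :
    SuperExchange numUV denUV ((yangianBlocks M N).map (seriesIn 0)).mat
      ((yangianBlocks M N).map (seriesIn 1)).mat := by
  intro i j h k
  simp only [mat_map_yangianBlocks, num_smul_eq_den_smul_iff, map_sub, map_zsmul, coeffUV_u_mul_v,
    coeffUV_v_mul_u, coeff_tSeries]
  exact ⟨genBracket_zero_left i j h k, genBracket_zero_right i j h k, genBracket_succ i j h k⟩

theorem superExchange_VU (M N : ℕ) :
    SuperExchange (-numUV) denUV ((yangianBlocks M N).map (seriesIn 1)).mat
      ((yangianBlocks M N).map (seriesIn 0)).mat := by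
  intro i j h k
  rw [neg_smul, ← smul_neg]
  simp only [mat_map_yangianBlocks, num_smul_eq_den_smul_iff, map_neg, map_sub, map_zsmul,
    coeffUV_u_mul_v, coeffUV_v_mul_u, coeff_tSeries]
  refine ⟨fun s => neg_eq_zero.2 (genBracket_zero_right i j h k s),
    fun r => neg_eq_zero.2 (genBracket_zero_left i j h k r), fun r s => ?_⟩
  rw [← genBracket_succ, neg_sub_neg]
  rfl

theorem exchange_UV (M N : ℕ) : Exchange numUV denUV ((yangianBlocks M N).map (seriesIn 0))
    ((yangianBlocks M N).map (seriesIn 1)) :=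
  (superExchange_UV M N).exchange (superExchange_VU M N)

theorem exchange_VU (M N : ℕ) : Exchange (-numUV) denUV ((yangianBlocks M N).map (seriesIn 1))
    ((yangianBlocks M N).map (seriesIn 0)) :=
  (superExchange_VU M N).exchange (by rw [neg_neg]; exact superExchange_UV M N)

/-- A product in one variable is a convolution, so commutation in one variable needs all pairs of
coefficients to commute; the two-variable identity `a'_g` says exactly that. -/
theorem commute_D₁'_D₂ {M N : ℕ} (i k : Fin M) (j h : Fin N) :
    D₁' i k * D₂ h j = (D₂ h j * D₁' i k : PowerSeries (Yangian M N)) := by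
  have key : ∀ r s, PowerSeries.coeff r (D₁' i k) * PowerSeries.coeff s (D₂ h j)
      = (PowerSeries.coeff s (D₂ h j) * PowerSeries.coeff r (D₁' i k) : Yangian M N) := by
    intro r s
    have := congrArg (coeffUV r s) ((exchange_UV M N).a'_g num_smul_eq_zero i k h j)
    rwa [← coeffUV_u_mul_v, ← coeffUV_v_mul_u]
  ext n
  rw [PowerSeries.coeff_mul, PowerSeries.coeff_mul,
    ← Finset.HasAntidiagonal.map_swap_antidiagonal, Finset.sum_map]
  exact Finset.sum_congr Finset.HasAntidiagonal.map_swap_antidiagonal.symm fun x _ => key _ _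

/-! ### Parities -/

/-- A series all of whose coefficients have parity `p`. -/
def HasParity {M N : ℕ} (p : ℕ) (A : PowerSeries (Yangian M N)) : Prop :=
  PowerSeries.map (sgn M N).toRingHom A = (-1 : ℤ) ^ p • A

theorem HasParity.sgn_coeff {M N : ℕ} {p : ℕ} {A : PowerSeries (Yangian M N)}
    (hA : HasParity p A) (r : ℕ) :
    sgn M N (PowerSeries.coeff r A) = (-1 : ℂ) ^ p • PowerSeries.coeff r A := by
  rw [neg_one_pow_smul, ← map_zsmul, ← hA, PowerSeries.coeff_map]
  rfl

theorem hasParity_tSeries {M N : ℕ} (i j : Idx M N) : HasParity (par i + par j) (tSeries i j) := by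
  unfold HasParity
  ext r
  rw [PowerSeries.coeff_map, map_zsmul, coeff_tSeries, ← neg_one_pow_smul]
  exact sgn_t i j r

theorem hasParity_D₁ {M N : ℕ} (i j : Fin M) : HasParity 0 (D₁ (N := N) i j) :=
  hasParity_tSeries (Sum.inl i) (Sum.inl j)

/-- Apply the parity automorphism to `D₁ E = b`: it fixes `D₁` and negates `b`, and `D₁` cancels. -/
theorem hasParity_E {M N : ℕ} (i : Fin M) (j : Fin N) : HasParity 1 (E i j) := by
  refine congrFun ((yangianBlocks M N).left_cancel
    (X := fun i => PowerSeries.map (sgn M N).toRingHom (E i j))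
    (Y := fun i => (-1 : ℤ) ^ 1 • E i j) fun i => ?_) i
  have h : ∀ q, D₁ i q = PowerSeries.map (sgn M N).toRingHom (D₁ i q) := fun q => by
    rw [hasParity_D₁ i q, pow_zero, one_smul]
  change ∑ q, D₁ i q * _ = ∑ q, D₁ i q * _
  simp only [mul_smul_comm, ← Finset.smul_sum, D₁_mul_E]
  rw [Finset.sum_congr rfl fun q _ => by rw [h q]]
  simp only [← map_mul, ← map_sum, D₁_mul_E]
  exact hasParity_tSeries _ _

theorem hasParity_F {M N : ℕ} (i : Fin N) (j : Fin M) : HasParity 1 (F i j) := by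
  refine congrFun ((yangianBlocks M N).right_cancel
    (X := fun j => PowerSeries.map (sgn M N).toRingHom (F i j))
    (Y := fun j => (-1 : ℤ) ^ 1 • F i j) fun j => ?_) j
  have h : ∀ q, D₁ q j = PowerSeries.map (sgn M N).toRingHom (D₁ q j) := fun q => by
    rw [hasParity_D₁ q j, pow_zero, one_smul]
  change ∑ q, _ * D₁ q j = ∑ q, _ * D₁ q j
  simp only [smul_mul_assoc, ← Finset.smul_sum, F_mul_D₁]
  rw [Finset.sum_congr rfl fun q _ => by rw [h q]]
  simp only [← map_mul, ← map_sum, F_mul_D₁]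
  exact hasParity_tSeries _ _

theorem hasParity_D₂ {M N : ℕ} (i j : Fin N) : HasParity 0 (D₂ (M := M) i j) := by
  have h : D₂ i j = tSeries (Sum.inr i) (Sum.inr j)
      - ∑ q : Fin M, F i q * tSeries (Sum.inl q) (Sum.inr j) := by
    rw [F_mul_tSeries_inl, sub_sub_cancel]
  unfold HasParity
  rw [h, map_sub, map_sum, hasParity_tSeries (Sum.inr i) (Sum.inr j),
    Finset.sum_congr rfl fun q _ => by
      rw [map_mul, hasParity_F i q, hasParity_tSeries (Sum.inl q) (Sum.inr j)]]
  simp [par]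

/-! ### The localization -/

/-- `toLSer` as a ring homomorphism. -/
def toLSerHom (M N : ℕ) : Ser M N →+* LSer M N where
  toFun := toLSer
  map_zero' := LocalizedModule.zero_mk 1
  map_one' := (OreLocalization.one_def).symm
  map_add' f g := by simp [toLSer]
  map_mul' f g := by simp [toLSer, LocalizedModule.mk_mul_mk]

theorem inU_eq {M N : ℕ} (A : PowerSeries (Yangian M N)) :
    inU A = toLSerHom M N (seriesIn 0 A) := rfl

theorem inV_eq {M N : ℕ} (A : PowerSeries (Yangian M N)) :
    inV A = toLSerHom M N (seriesIn 1 A) := rfl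

/-- The coefficient of `u^{-r} v^{-s}` in either product involves a single coefficient of each
series, so homogeneity can be used coefficient by coefficient. -/
theorem brUV_eq {M N : ℕ} {p q : ℕ} {A B : PowerSeries (Yangian M N)} (hA : HasParity p A)
    (hB : HasParity q B) : brUV A B = toLSerHom M N
      (seriesIn 0 A * seriesIn 1 B - (-1 : ℤ) ^ (p * q) • (seriesIn 1 B * seriesIn 0 A)) := by
  refine congrArg toLSer (ext_coeffUV fun r s => ?_)
  rw [map_sub, map_zsmul, coeffUV_u_mul_v, coeffUV_v_mul_u, ← neg_one_pow_smul,
    ← sbr_of_homogeneous _ _ p q (hA.sgn_coeff r) (hB.sgn_coeff s)]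
  change sbr (PowerSeries.coeff ((Finsupp.single 0 r + Finsupp.single 1 s : Fin 2 →₀ ℕ) 0) A)
    (PowerSeries.coeff ((Finsupp.single 0 r + Finsupp.single 1 s : Fin 2 →₀ ℕ) 1) B) = _
  simp

/-- The bridge to the localization: `u - v` is the fraction `numUV / denUV` there. -/
theorem sub_mul_toLSer {M N : ℕ} {f g : Ser M N} (h : numUV • f = denUV • g) :
    (varU M N - varV M N) * toLSerHom M N f = toLSerHom M N g := by
  change (LocalizedModule.mk _ _ - LocalizedModule.mk _ _) * LocalizedModule.mk f 1
    = LocalizedModule.mk g 1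
  rw [sub_mul, LocalizedModule.mk_mul_mk, LocalizedModule.mk_mul_mk, one_mul, mul_one, mul_one,
    sub_eq_add_neg, ← LocalizedModule.mk_neg, LocalizedModule.mk_add_mk, LocalizedModule.mk_eq]
  refine ⟨1, ?_⟩
  simp only [one_smul, Submonoid.smul_def, Submonoid.coe_mul, smul_neg, ← sub_eq_add_neg,
    ← sub_smul]
  exact h

theorem num_e_e {M N : ℕ} (i : Fin M) (j : Fin N) (h : Fin M) (k : Fin N) :
    numUV • (seriesIn 0 (E i j) * seriesIn 1 (E h k) + seriesIn 1 (E h k) * seriesIn 0 (E i j))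
      = denUV • ((seriesIn 0 (E i k) - seriesIn 1 (E i k))
        * (seriesIn 1 (E h j) - seriesIn 0 (E h j))) := by
  rw [← sub_eq_zero]
  -- The involution exchanges the column indices `j`, `k` and keeps the rows; the inhomogeneous term
  -- is the anticommutator of two entries of `E(v)`, which need not be known to vanish.
  refine eq_zero_of_num_den (ι := (Fin M × Fin M) × (Fin N × Fin N)) (Prod.map id Prod.swap)
    (fun x => rfl)
    (fun x => numUV • (seriesIn 0 (E x.1.1 x.2.1) * seriesIn 1 (E x.1.2 x.2.2)
        + seriesIn 1 (E x.1.2 x.2.2) * seriesIn 0 (E x.1.1 x.2.1))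
      - denUV • ((seriesIn 0 (E x.1.1 x.2.2) - seriesIn 1 (E x.1.1 x.2.2))
        * (seriesIn 1 (E x.1.2 x.2.1) - seriesIn 0 (E x.1.2 x.2.1))))
    (fun x => seriesIn 1 (E x.1.2 x.2.1) * seriesIn 1 (E x.1.1 x.2.2)
      + seriesIn 1 (E x.1.1 x.2.2) * seriesIn 1 (E x.1.2 x.2.1))
    (fun x r s => ?_) (fun x => ?_) ((i, h), (j, k))
  · simp only [← map_mul, ← map_add]
    rw [coeffUV_seriesIn_one, if_neg r.succ_ne_zero]
  · exact (exchange_UV M N).e_e_aux x.1.1 x.2.1 x.1.2 x.2.2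

theorem num_f_f {M N : ℕ} (i : Fin N) (j : Fin M) (h : Fin N) (k : Fin M) :
    numUV • (seriesIn 0 (F i j) * seriesIn 1 (F h k) + seriesIn 1 (F h k) * seriesIn 0 (F i j))
      = denUV • ((seriesIn 0 (F i k) - seriesIn 1 (F i k))
        * (seriesIn 1 (F h j) - seriesIn 0 (F h j))) := by
  rw [← sub_eq_zero]
  -- Here the involution exchanges the row indices `i`, `h`, as in `f_f_aux`.
  refine eq_zero_of_num_den (ι := (Fin N × Fin N) × (Fin M × Fin M)) (Prod.map Prod.swap id)
    (fun x => rfl)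
    (fun x => numUV • (seriesIn 0 (F x.1.1 x.2.1) * seriesIn 1 (F x.1.2 x.2.2)
        + seriesIn 1 (F x.1.2 x.2.2) * seriesIn 0 (F x.1.1 x.2.1))
      - denUV • ((seriesIn 0 (F x.1.1 x.2.2) - seriesIn 1 (F x.1.1 x.2.2))
        * (seriesIn 1 (F x.1.2 x.2.1) - seriesIn 0 (F x.1.2 x.2.1))))
    (fun x => seriesIn 1 (F x.1.2 x.2.1) * seriesIn 1 (F x.1.1 x.2.2)
      + seriesIn 1 (F x.1.1 x.2.2) * seriesIn 1 (F x.1.2 x.2.1))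
    (fun x r s => ?_) (fun x => ?_) ((i, h), (j, k))
  · simp only [← map_mul, ← map_add]
    rw [coeffUV_seriesIn_one, if_neg r.succ_ne_zero]
  · exact (exchange_UV M N).f_f_aux x.1.1 x.2.1 x.1.2 x.2.2

end SuperYangian

end
open SuperYangian in
/-- The relations among the series `D_1`, `D_2`, `E`, `F` of the super Yangian `Y(gl_{M|N})` for the
composition `(M | N)`, in `Y(gl_{M|N})((u⁻¹, v⁻¹))`. -/
theorem proposition5p1 (M N : ℕ) :
    (∀ (i j h : Fin M) (k : Fin N),
      (varU M N - varV M N) * brUV (D₁ i j) (E h k) =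
        if h = j then ∑ p : Fin M, inU (D₁ i p) * (inV (E p k) - inU (E p k)) else 0) ∧
    (∀ (i j : Fin N) (h : Fin M) (k : Fin N),
      (varU M N - varV M N) * brUV (D₂ i j) (E h k) =
        inU (D₂ i k) * (inV (E h j) - inU (E h j))) ∧
    (∀ (i j : Fin M) (h : Fin N) (k : Fin M),
      (varU M N - varV M N) * brUV (D₁ i j) (F h k) =
        if k = i then ∑ p : Fin M, (inU (F h p) - inV (F h p)) * inU (D₁ p j) else 0) ∧
    (∀ (i j h : Fin N) (k : Fin M),
      (varU M N - varV M N) * brUV (D₂ i j) (F h k) =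
        (inU (F i k) - inV (F i k)) * inU (D₂ h j)) ∧
    (∀ (i : Fin M) (j h : Fin N) (k : Fin M),
      (varU M N - varV M N) * brUV (E i j) (F h k) =
        inV (D₁' i k) * inV (D₂ h j) - inU (D₂ h j) * inU (D₁' i k)) ∧
    (∀ (i : Fin M) (j : Fin N) (h : Fin M) (k : Fin N),
      (varU M N - varV M N) * brUV (E i j) (E h k) =
        (inU (E i k) - inV (E i k)) * (inV (E h j) - inU (E h j))) ∧
    (∀ (i : Fin N) (j : Fin M) (h : Fin N) (k : Fin M),
      (varU M N - varV M N) * brUV (F i j) (F h k) =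
        (inU (F i k) - inV (F i k)) * (inV (F h j) - inU (F h j))) := by
  have H := exchange_UV M N
  have H' := exchange_VU M N
  simp only [inU_eq, inV_eq, ← map_sub, ← map_mul, ← map_sum]
  refine ⟨fun i j h k => ?_, fun i j h k => ?_, fun i j h k => ?_, fun i j h k => ?_,
    fun i j h k => ?_, fun i j h k => ?_, fun i j h k => ?_⟩
  · rw [brUV_eq (hasParity_D₁ i j) (hasParity_E h k), ← map_zero (toLSerHom M N), ← apply_ite]
    apply sub_mul_toLSer
    rw [zero_mul, pow_zero, one_smul]
    exact H.a_e i j h k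
  · rw [brUV_eq (hasParity_D₂ i j) (hasParity_E h k)]
    apply sub_mul_toLSer
    rw [zero_mul, pow_zero, one_smul]
    exact H.g_e H' num_smul_eq_zero i j h k
  · rw [brUV_eq (hasParity_D₁ i j) (hasParity_F h k), ← map_zero (toLSerHom M N), ← apply_ite]
    apply sub_mul_toLSer
    rw [zero_mul, pow_zero, one_smul]
    exact H.a_f i j h k
  · rw [brUV_eq (hasParity_D₂ i j) (hasParity_F h k)]
    apply sub_mul_toLSer
    rw [zero_mul, pow_zero, one_smul]
    exact H.g_f H' num_smul_eq_zero i j h k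
  · rw [brUV_eq (hasParity_E i j) (hasParity_F h k)]
    apply sub_mul_toLSer
    -- The relation `e_f` has its factors in the opposite order in both terms; commutation brings
    -- `D₂` to the front in the goal and in `this`.
    rw [one_mul, pow_one, neg_one_smul, sub_neg_eq_add, commute_D₁'_D₂]
    have := H.e_f num_smul_eq_zero i j h k
    change _ = denUV • (seriesIn 1 (D₂ h j) * seriesIn 1 (D₁' i k)
      - seriesIn 0 (D₁' i k) * seriesIn 0 (D₂ h j)) at this
    rwa [← map_mul, ← map_mul, commute_D₁'_D₂] at this
  · rw [brUV_eq (hasParity_E i j) (hasParity_E h k)]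
    apply sub_mul_toLSer
    rw [one_mul, pow_one, neg_one_smul, sub_neg_eq_add]
    exact num_e_e i j h k
  · rw [brUV_eq (hasParity_F i j) (hasParity_F h k)]
    apply sub_mul_toLSer
    rw [one_mul, pow_one, neg_one_smul, sub_neg_eq_add]
    exact num_f_f i j h k
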